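/- Let $0<a_0<a_1<\dots<a_n$ be real numbers and let $D\subset\mathbb{R}^n$ be the open set of all $x=(x^1,\dots,x^n)$ with $a_0<x^1<a_1<x^2<\dots<x^n<a_n$. Consider on $D$ the diagonal (dual Moser Stäckel) metric $$g=\sum_{i=1}^n g_i(x)\,(dx^i)^2,\qquad g_i(x)=\frac{\tilde g_i(x)}{x^i},\qquad \tilde g_i(x)=-\frac14\,\frac{\prod_{j\neq i}(x^i-x^j)}{\prod_{\alpha=0}^n(x^i-a_\alpha)} .$$ With the conventions $R^{\ell}{}_{i,jk}=\partial_j\Gamma^\ell_{ik}-\partial_k\Gamma^\ell_{ij}+\sum_s(\Gamma^\ell_{sj}\Gamma^s_{ik}-\Gamma^\ell_{sk}\Gamma^s_{ij})$, $R_{ij}=\sum_s R^s{}_{i,sj}$ and $R=\sum_{i,j}g^{ij}R_{ij}$, where $\Gamma^k_{ij}$ are the Christoffel symbols of $g$, the following holds at every $x\in D$. 1. The Ricci tensor of $g$ is $$R_{ij}=\Big((n-2)\,x^i+n\sum_{k=1}^n x^k-(n-1)\sum_{\alpha=0}^n a_\alpha\Big)\,g_i(x)\,\delta_{ij}.$$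 2. The scalar curvature of $g$ is $$R=(n-1)\Big((n+2)\sum_{k=1}^n x^k-n\sum_{\alpha=0}^n a_\alpha\Big).$$ 3. If $n\ge3$, then $g$ is conformally flat: every point of $D$ has an open neighbourhood $W\subset D$ on which $g=e^{2\varphi}\,\psi^*g_{\mathrm{eucl}}$ for a smooth function $\varphi:W\to\mathbb{R}$ and a diffeomorphism $\psi$ from $W$ onto an open subset of Euclidean $\mathbb{R}^n$. 4. If $n\ge4$, the conformal Weyl tensor of $g$ vanishes; if $n=3$, the Cotton–York tensor $C_{ijk}=\nabla_iP_{jk}-\nabla_jP_{ik}$ vanishes, where $P_{ij}=\frac{1}{n-2}\big(R_{ij}-\frac{R}{2(n-1)}g_{ij}\big)$. -/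

import Mathlib

open scoped ContDiff

noncomputable section

/-! Riemannian geometry in a coordinate chart: a point of the chart is `x : Fin n → ℝ`, and a metric
is given by the matrix-valued function `G`, where `G x i j` is the component `g_ij(x)`. -/

/-- The coordinate partial derivative `∂_i f` at `x`. -/
def partialD {n : ℕ} (i : Fin n) (f : (Fin n → ℝ) → ℝ) (x : Fin n → ℝ) : ℝ :=
  fderiv ℝ f x (Pi.single i 1)

/-- The Christoffel symbols `Γ^k_ij` of the Levi-Civita connection of `G`. -/
def christoffel {n : ℕ} (G : (Fin n → ℝ) → Matrix (Fin n) (Fin n) ℝ) (x : Fin n → ℝ)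
    (k i j : Fin n) : ℝ :=
  (1 / 2) * ∑ l, (G x)⁻¹ k l *
    (partialD i (fun y => G y l j) x + partialD j (fun y => G y l i) x
      - partialD l (fun y => G y i j) x)

/-- The Riemann tensor
`R^l_{i,jk} = ∂_j Γ^l_ik - ∂_k Γ^l_ij + ∑_s (Γ^l_sj Γ^s_ik - Γ^l_sk Γ^s_ij)`. -/
def riemann {n : ℕ} (G : (Fin n → ℝ) → Matrix (Fin n) (Fin n) ℝ) (x : Fin n → ℝ)
    (l i j k : Fin n) : ℝ :=
  partialD j (fun y => christoffel G y l i k) x - partialD k (fun y => christoffel G y l i j) x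
    + ∑ s, (christoffel G x l s j * christoffel G x s i k
      - christoffel G x l s k * christoffel G x s i j)

/-- The Riemann tensor with its first index lowered, `R_{li,jk} = ∑_m g_lm R^m_{i,jk}`. -/
def riemannLow {n : ℕ} (G : (Fin n → ℝ) → Matrix (Fin n) (Fin n) ℝ) (x : Fin n → ℝ)
    (l i j k : Fin n) : ℝ :=
  ∑ m, G x l m * riemann G x m i j k

/-- The Ricci tensor `R_ij = ∑_s R^s_{i,sj}`. -/
def ricci {n : ℕ} (G : (Fin n → ℝ) → Matrix (Fin n) (Fin n) ℝ) (x : Fin n → ℝ)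
    (i j : Fin n) : ℝ :=
  ∑ s, riemann G x s i s j

/-- The scalar curvature `R = ∑_ij g^ij R_ij`. -/
def scalarCurvature {n : ℕ} (G : (Fin n → ℝ) → Matrix (Fin n) (Fin n) ℝ) (x : Fin n → ℝ) : ℝ :=
  ∑ i, ∑ j, (G x)⁻¹ i j * ricci G x i j

/-- The Schouten tensor `P_ij = (R_ij - R g_ij / (2 (n - 1))) / (n - 2)`, meaningful for `n ≥ 3`. -/
def schouten {n : ℕ} (G : (Fin n → ℝ) → Matrix (Fin n) (Fin n) ℝ) (x : Fin n → ℝ)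
    (i j : Fin n) : ℝ :=
  (ricci G x i j - scalarCurvature G x / (2 * ((n : ℝ) - 1)) * G x i j) / ((n : ℝ) - 2)

/-- The conformal Weyl tensor
`W_lijk = R_{li,jk} - (g_lj P_ik - g_lk P_ij + g_ik P_lj - g_ij P_lk)`, meaningful for `n ≥ 3`. -/
def weyl {n : ℕ} (G : (Fin n → ℝ) → Matrix (Fin n) (Fin n) ℝ) (x : Fin n → ℝ)
    (l i j k : Fin n) : ℝ :=
  riemannLow G x l i j k
    - (G x l j * schouten G x i k - G x l k * schouten G x i j
      + G x i k * schouten G x l j - G x i j * schouten G x l k)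

/-- The covariant derivative `∇_k P_ij` of the Schouten tensor. -/
def covSchouten {n : ℕ} (G : (Fin n → ℝ) → Matrix (Fin n) (Fin n) ℝ) (x : Fin n → ℝ)
    (k i j : Fin n) : ℝ :=
  partialD k (fun y => schouten G y i j) x
    - ∑ s, (christoffel G x s k i * schouten G x s j + christoffel G x s k j * schouten G x i s)

/-- The Cotton (Cotton–York) tensor `C_ijk = ∇_i P_jk - ∇_j P_ik`, meaningful for `n ≥ 3`. -/
def cotton {n : ℕ} (G : (Fin n → ℝ) → Matrix (Fin n) (Fin n) ℝ) (x : Fin n → ℝ)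
    (i j k : Fin n) : ℝ :=
  covSchouten G x i j k - covSchouten G x j i k

/-- The metric `G` on the open set `D` is conformally flat: near every point of `D` there are a
smooth diffeomorphism `ψ` onto an open subset of `ℝⁿ` and a smooth function `φ` such that `G` is
`exp (2 φ)` times the pullback by `ψ` of the Euclidean metric. -/
def IsConformallyFlatOn {n : ℕ} (G : (Fin n → ℝ) → Matrix (Fin n) (Fin n) ℝ)
    (D : Set (Fin n → ℝ)) : Prop :=
  ∀ p ∈ D, ∃ W : Set (Fin n → ℝ), IsOpen W ∧ p ∈ W ∧ W ⊆ D ∧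
    ∃ (ψ : (Fin n → ℝ) → (Fin n → ℝ)) (φ : (Fin n → ℝ) → ℝ),
      ContDiffOn ℝ ∞ ψ W ∧ ContDiffOn ℝ ∞ φ W ∧ Set.InjOn ψ W ∧
      ∀ x ∈ W, Function.Bijective (fderiv ℝ ψ x) ∧
        ∀ i j : Fin n, G x i j =
          Real.exp (2 * φ x) *
            ∑ k, fderiv ℝ ψ x (Pi.single i 1) k * fderiv ℝ ψ x (Pi.single j 1) k

/-! The metric under study. -/

/-- The range of the ellipsoidal coordinates, `a₀ < x¹ < a₁ < x² < ⋯ < xⁿ < aₙ`. -/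
def ellipsoidalDomain {n : ℕ} (a : Fin (n + 1) → ℝ) : Set (Fin n → ℝ) :=
  {x | ∀ i : Fin n, a i.castSucc < x i ∧ x i < a i.succ}

/-- The Neumann–Uhlenbeck coefficient
`g̃_i(x) = -(1/4) ∏_{j ≠ i} (xⁱ - xʲ) / ∏_α (xⁱ - a_α)`. -/
def neumannCoeff {n : ℕ} (a : Fin (n + 1) → ℝ) (x : Fin n → ℝ) (i : Fin n) : ℝ :=
  -(1 / 4) * ((∏ j ∈ Finset.univ.erase i, (x i - x j)) / ∏ α, (x i - a α))

/-- The dual Moser coefficient `g_i(x) = g̃_i(x) / xⁱ`. -/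
def dualMoserCoeff {n : ℕ} (a : Fin (n + 1) → ℝ) (x : Fin n → ℝ) (i : Fin n) : ℝ :=
  neumannCoeff a x i / x i

/-- The dual Moser Stäckel metric `g = ∑_i g_i(x) (dxⁱ)²`. -/
def dualMoserMetric {n : ℕ} (a : Fin (n + 1) → ℝ) (x : Fin n → ℝ) : Matrix (Fin n) (Fin n) ℝ :=
  Matrix.diagonal (dualMoserCoeff a x)

end

/-! ### Lagrange weights, divided differences and their confluent forms. -/

section DividedDifferences

open Polynomial Finset

variable {ι : Type*} [DecidableEq ι]

/-! Write `B_lk = ∂_k log |g_l|`. Off the diagonal `B_lk = 1 / (x^k - x^l)`, free of the `a_α`, so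
in the curvature of this diagonal metric every component other than `R^l_{i,li}` and its
antisymmetric partner cancels by partial fractions. In `R^l_{i,li}` one genuine sum remains, `∑_s
B_ls B_is / g_s`. Since `1 / g_s = -4 P(x^s) / ∏_{m ≠ s} (x^s - x^m)` with `P = X ∏ (X - a_α)`, this
sum is part of a divided difference of `P` with the nodes `x^l` and `x^i` doubled, which is read off
from the two top coefficients of `P`. The sectional curvatures are therefore `K_li = x^l + x^i + ∑ x
- ∑ a` (`riemann_dualMoserMetric`). Contraction gives the Ricci and scalar curvatures. As `K_li` is
a sum of a term in `l` and a term in `i`, the Riemann tensor is built from `g` and the Schouten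
tensor, so Weyl vanishes; `∇P` is totally symmetric, so Cotton vanishes.

Conformal flatness is proved by an explicit chart, independently of these tensors. With nodes `b =
(0, a_0, …, a_n)`, the functions `y_k² = ± ∏_i (b_k - x^i) / ∏_{m ≠ k} (b_k - b_m)` embed `D` in the
light cone of `ℝ^{1,n+1}` and pull the Minkowski form back to `g`. Rescaling along the rays of the
cone changes the induced metric only conformally, and the slice `y_0 + y_1 = 1` is Euclidean
(`dualMoserMetric_eq_conformal`). -/

theorem eval_derivative_nodal_eq_mul_sum_inv (s : Finset ι) (v : ι → ℝ) (y : ℝ)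
    (hy : ∀ k ∈ s, y ≠ v k) :
    (derivative (Lagrange.nodal s v)).eval y =
      (∏ k ∈ s, (y - v k)) * ∑ k ∈ s, (y - v k)⁻¹ := by
  rw [Lagrange.derivative_nodal, eval_finsetSum, mul_sum]
  refine sum_congr rfl fun k hk => ?_
  rw [Lagrange.eval_nodal, ← mul_prod_erase s _ hk]
  have := sub_ne_zero.2 (hy k hk)
  field_simp

/-- The derivative at `y` of the partial fraction expansion of the reciprocal of the nodal
polynomial. -/
theorem sum_nodalWeight_mul_inv_sq (s : Finset ι) (v : ι → ℝ) (hv : Set.InjOn v s) (y : ℝ)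
    (hy : ∀ k ∈ s, y ≠ v k) :
    ∑ k ∈ s, (∏ m ∈ s.erase k, (v k - v m))⁻¹ * (y - v k)⁻¹ * (y - v k)⁻¹ =
      (∏ k ∈ s, (y - v k))⁻¹ * ∑ k ∈ s, (y - v k)⁻¹ := by
  set N := Lagrange.nodal s v with hN
  -- The difference quotient of `N` at `y` has degree below `#s`, takes the values `N(y) / (y - v
  -- k)` at the nodes and `N'(y)` at `y`; Lagrange interpolation of it, evaluated at `y`, is the
  -- claim.
  set p : ℝ[X] := (N - C (N.eval y)) /ₘ (X - C y) with hp
  have hdiv : (X - C y) * p = N - C (N.eval y) := by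
    rw [hp, mul_divByMonic_eq_iff_isRoot]
    simp
  have hNy : N.eval y = ∏ k ∈ s, (y - v k) := Lagrange.eval_nodal
  have hN0 : N.eval y ≠ 0 := Lagrange.eval_nodal_not_at_node hy
  rcases s.eq_empty_or_nonempty with rfl | hs
  · simp
  have hcard : 0 < #s := hs.card_pos
  have hdeg : p.degree < #s := by
    have hnd : p.natDegree < #s := by
      rw [hp, natDegree_divByMonic _ (monic_X_sub_C y), natDegree_X_sub_C, natDegree_sub_C, hN,
        Lagrange.natDegree_nodal]
      omega
    exact lt_of_le_of_lt degree_le_natDegree (by exact_mod_cast hnd)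
  have hpk : ∀ k ∈ s, p.eval (v k) = N.eval y * (y - v k)⁻¹ := by
    intro k hk
    have h := congrArg (eval (v k)) hdiv
    simp only [eval_mul, eval_sub, eval_X, eval_C] at h
    rw [hN, Lagrange.eval_nodal_at_node hk, ← hN] at h
    have := sub_ne_zero.2 (hy k hk)
    field_simp
    linarith
  have hpy : p.eval y = (derivative N).eval y := by
    have h := congrArg (fun q => eval y (derivative q)) hdiv
    simpa using h
  have h1 := Lagrange.eval_interpolate_not_at_node (s := s) (v := v) (fun k => p.eval (v k)) hy
  rw [← Lagrange.eq_interpolate hv hdeg, hpy, hN,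
    eval_derivative_nodal_eq_mul_sum_inv s v y hy, ← hN, ← hNy] at h1
  have h2 := mul_left_cancel₀ hN0 h1
  rw [h2, ← hNy, mul_sum]
  refine sum_congr rfl fun k hk => ?_
  rw [hpk k hk, Lagrange.nodalWeight, prod_inv_distrib]
  field_simp

/-- The divided difference of the constant 1 with node `v i` doubled is zero. It follows from the
preceding identity for the remaining nodes at `y = v i`. -/
theorem sum_erase_inv_sub_mul_nodalWeight (s : Finset ι) (v : ι → ℝ) (hv : Set.InjOn v s) {i : ι}
    (hi : i ∈ s) :
    ∑ k ∈ s.erase i, (v k - v i)⁻¹ * (∏ m ∈ s.erase k, (v k - v m))⁻¹ =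
      (∏ m ∈ s.erase i, (v i - v m))⁻¹ * ∑ k ∈ s.erase i, (v i - v k)⁻¹ := by
  have hne : ∀ k ∈ s.erase i, v i ≠ v k := fun k hk h =>
    (mem_erase.1 hk).1 (hv (mem_erase.1 hk).2 hi h.symm)
  rw [← sum_nodalWeight_mul_inv_sq (s.erase i) v
    (hv.mono (by exact_mod_cast erase_subset i s)) (v i) hne]
  refine sum_congr rfl fun k hk => ?_
  have hik : i ∈ s.erase k := mem_erase.2 ⟨(mem_erase.1 hk).1.symm, hi⟩
  rw [← mul_prod_erase (s.erase k) _ hik, erase_right_comm, mul_inv, ← neg_sub (v i) (v k),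
    inv_neg]
  ring

/-- The divided difference of a monic polynomial of degree `#s` over the nodes `v k`. -/
theorem sum_eval_mul_nodalWeight_of_monic (s : Finset ι) (v : ι → ℝ) (hv : Set.InjOn v s)
    (hs : s.Nonempty) (q : ℝ[X]) (hq : q.Monic) (hdeg : q.natDegree = #s) :
    ∑ k ∈ s, q.eval (v k) * (∏ m ∈ s.erase k, (v k - v m))⁻¹ = q.nextCoeff + ∑ k ∈ s, v k := by
  have hcard : 0 < #s := hs.card_pos
  set N := Lagrange.nodal s v with hN
  -- Subtracting `N` changes no value at a node and lowers the degree, so Lagrange's formula for the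
  -- coefficient of degree `#s - 1` applies.
  have hlt : (q - N).degree < #s := by
    have h := degree_sub_lt_left (p := q) (q := N)
      (by rw [hN, Lagrange.degree_nodal, degree_eq_natDegree hq.ne_zero, hdeg]) hq.ne_zero
      (by rw [hq.leadingCoeff, (Lagrange.nodal_monic (s := s) (v := v)).leadingCoeff])
    rwa [degree_eq_natDegree hq.ne_zero, hdeg] at h
  have h := Lagrange.coeff_eq_sum hv hlt
  have hNc : N.coeff (#s - 1) = -∑ k ∈ s, v k := by
    rw [hN, Lagrange.nodal]
    exact prod_X_sub_C_coeff_card_pred s v hcard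
  rw [coeff_sub, hNc, ← hdeg, ← nextCoeff_of_natDegree_pos (by omega), sub_neg_eq_add] at h
  rw [h]
  refine sum_congr rfl fun k hk => ?_
  rw [eval_sub, hN, Lagrange.eval_nodal_at_node hk, sub_zero, div_eq_mul_inv]

/-- The divided difference of a monic polynomial of degree `#s + 2` over the nodes `v k`, in which
the two nodes `v i` and `v j` are taken twice. -/
theorem sum_eval_mul_nodalWeight_two_double_nodes (s : Finset ι) (v : ι → ℝ) (hv : Set.InjOn v s)
    {i j : ι} (hi : i ∈ s) (hj : j ∈ s) (hij : i ≠ j) (P : ℝ[X]) (hP : P.Monic)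
    (hdeg : P.natDegree = #s + 2) :
    ∑ k ∈ (s.erase i).erase j, P.eval (v k) * ((v k - v i)⁻¹ * (v k - v j)⁻¹) *
        (∏ m ∈ s.erase k, (v k - v m))⁻¹ =
      P.nextCoeff + ∑ k ∈ s, v k + v i + v j
        - ((derivative P).eval (v i) - P.eval (v i) *
            (∑ k ∈ s.erase i, (v i - v k)⁻¹ + (v i - v j)⁻¹)) * (v i - v j)⁻¹ *
              (∏ m ∈ s.erase i, (v i - v m))⁻¹
        - ((derivative P).eval (v j) - P.eval (v j) *
            (∑ k ∈ s.erase j, (v j - v k)⁻¹ + (v j - v i)⁻¹)) * (v j - v i)⁻¹ *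
              (∏ m ∈ s.erase j, (v j - v m))⁻¹ := by
  have hvij : v i ≠ v j := fun h => hij (hv hi hj h)
  have hvij' : v i - v j ≠ 0 := sub_ne_zero.2 hvij
  have hji' : v j - v i ≠ 0 := sub_ne_zero.2 hvij.symm
  -- Dividing by `M` turns the two extra nodes into a linear remainder `β X + α`; the quotient `q`
  -- is monic of degree `#s`, so the simple-node formula handles it.
  set M : ℝ[X] := (X - C (v i)) * (X - C (v j)) with hM
  have hMm : M.Monic := (monic_X_sub_C _).mul (monic_X_sub_C _)
  have hMd : M.natDegree = 2 := by
    rw [hM, (monic_X_sub_C _).natDegree_mul (monic_X_sub_C _), natDegree_X_sub_C,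
      natDegree_X_sub_C]
  set q : ℝ[X] := P /ₘ M with hq
  have hrd : (P %ₘ M).natDegree ≤ 1 := by
    have := natDegree_modByMonic_lt P hMm (by intro h; rw [h] at hMd; simp at hMd)
    omega
  obtain ⟨β, α, hr⟩ := exists_eq_X_add_C_of_natDegree_le_one hrd
  have hPq : P = C β * X + C α + M * q := by rw [← hr, hq, modByMonic_add_div]
  have hqd : q.natDegree = #s := by rw [hq, natDegree_divByMonic _ hMm, hdeg, hMd]; simp
  have hcard : 0 < #s := card_pos.2 ⟨i, hi⟩
  have hqm : q.Monic := by
    have h := leadingCoeff_divByMonic_of_monic (p := P) hMm (by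
      rw [degree_eq_natDegree hMm.ne_zero, degree_eq_natDegree hP.ne_zero, hMd, hdeg]
      exact_mod_cast by omega)
    rw [Monic, hq, h, hP.leadingCoeff]
  have hnext : q.nextCoeff = P.nextCoeff + v i + v j := by
    have h1 : (M * q).nextCoeff = -v i + -v j + q.nextCoeff := by
      rw [hMm.nextCoeff_mul hqm, hM, (monic_X_sub_C _).nextCoeff_mul (monic_X_sub_C _),
        nextCoeff_X_sub_C, nextCoeff_X_sub_C]
    have hMq : (M * q).natDegree = #s + 2 := by rw [hMm.natDegree_mul hqm, hMd, hqd, add_comm]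
    have h2 : P.nextCoeff = (M * q).nextCoeff := by
      rw [nextCoeff_of_natDegree_pos (by omega), nextCoeff_of_natDegree_pos (by omega), hdeg, hMq]
      conv_lhs => rw [hPq]
      have h3 : #s + 2 - 1 = (#s) + 1 := by omega
      rw [h3, coeff_add, coeff_add, coeff_C_mul, coeff_X, coeff_C]
      simp [Finset.Nonempty.ne_empty ⟨i, hi⟩]
    rw [h2, h1]; ring
  have hev : ∀ t, P.eval t = β * t + α + (t - v i) * (t - v j) * q.eval t := by
    intro t
    conv_lhs => rw [hPq]
    simp [hM]
  have hdev : ∀ t, (derivative P).eval t = β + ((t - v j) + (t - v i)) * q.eval t +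
      (t - v i) * (t - v j) * (derivative q).eval t := by
    intro t
    conv_lhs => rw [hPq]
    simp [hM]
    ring
  have hΛ := sum_eval_mul_nodalWeight_of_monic s v hv ⟨i, hi⟩ q hqm hqd
  have hEi := sum_erase_inv_sub_mul_nodalWeight s v hv hi
  have hEj := sum_erase_inv_sub_mul_nodalWeight s v hv hj
  have hji : j ∈ s.erase i := mem_erase.2 ⟨hij.symm, hj⟩
  have hij2 : i ∈ s.erase j := mem_erase.2 ⟨hij, hi⟩
  rw [← add_sum_erase s _ hi, ← add_sum_erase _ _ hji] at hΛ
  rw [← add_sum_erase _ _ hji] at hEi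
  rw [← add_sum_erase _ _ hij2, erase_right_comm] at hEj
  -- Partial fractions of the remainder, whose values at `v i` and `v j` are those of `P`. The
  -- resulting two sums are evaluated by `hEi` and `hEj`.
  have hterm : ∀ k ∈ (s.erase i).erase j,
      P.eval (v k) * ((v k - v i)⁻¹ * (v k - v j)⁻¹) * (∏ m ∈ s.erase k, (v k - v m))⁻¹ =
      q.eval (v k) * (∏ m ∈ s.erase k, (v k - v m))⁻¹ +
      (v i - v j)⁻¹ * (P.eval (v i) * ((v k - v i)⁻¹ * (∏ m ∈ s.erase k, (v k - v m))⁻¹)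
        - P.eval (v j) * ((v k - v j)⁻¹ * (∏ m ∈ s.erase k, (v k - v m))⁻¹)) := by
    intro k hk
    have hks : k ∈ s := (mem_erase.1 (mem_erase.1 hk).2).2
    have h1 : v k - v i ≠ 0 := sub_ne_zero.2 fun h => (mem_erase.1 (mem_erase.1 hk).2).1 (hv hks hi h)
    have h2 : v k - v j ≠ 0 := sub_ne_zero.2 fun h => (mem_erase.1 hk).1 (hv hks hj h)
    rw [hev (v k), hev (v i), hev (v j)]
    generalize (∏ m ∈ s.erase k, (v k - v m))⁻¹ = w
    generalize eval (v k) q = Q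
    field_simp
    ring
  rw [sum_congr rfl hterm, sum_add_distrib, ← mul_sum, sum_sub_distrib, ← mul_sum, ← mul_sum,
    eq_sub_of_add_eq' hEi, eq_sub_of_add_eq' hEj, eq_sub_of_add_eq' (eq_sub_of_add_eq' hΛ),
    hnext, hdev, hdev, hev (v i), hev (v j)]
  generalize (∏ m ∈ s.erase i, (v i - v m))⁻¹ = wi
  generalize (∏ m ∈ s.erase j, (v j - v m))⁻¹ = wj
  rw [← neg_sub (v i) (v j), inv_neg]
  field_simp
  ring

/-- Divided differences of order `#s - 1` kill polynomials of lower degree. -/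
theorem sum_nodalWeight_mul_eval_eq_zero (s : Finset ι) (v : ι → ℝ) (hv : Set.InjOn v s) (q : ℝ[X])
    (hq : q.natDegree + 1 < #s) :
    ∑ k ∈ s, Lagrange.nodalWeight s v k * q.eval (v k) = 0 := by
  have hlt : q.degree < #s :=
    lt_of_le_of_lt degree_le_natDegree (by exact_mod_cast (by omega : q.natDegree < #s))
  rw [← coeff_eq_zero_of_natDegree_lt (p := q) (n := #s - 1) (by omega),
    Lagrange.coeff_eq_sum hv hlt]
  refine sum_congr rfl fun k _ => ?_
  rw [Lagrange.nodalWeight, prod_inv_distrib, div_eq_mul_inv, mul_comm]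

end DividedDifferences

/-! ### Logarithmic differentiation without logarithms. -/

section LogarithmicGradients

variable {E : Type*} [NormedAddCommGroup E] [NormedSpace ℝ E] {f g : E → ℝ} {u v : E →L[ℝ] ℝ}
  {x : E}

/-- Differentials are kept in the form `f x • u`, with `u` playing the role of `d log |f|`: products
add the `u`s, whatever the signs of the factors. -/
theorem hasFDerivAt_log_mul (hf : HasFDerivAt f (f x • u) x) (hg : HasFDerivAt g (g x • v) x) :
    HasFDerivAt (fun y => f y * g y) ((f x * g x) • (u + v)) x := by
  refine (hf.mul hg).congr_fderiv ?_
  ext w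
  simp
  ring

theorem hasFDerivAt_log_inv (hf : HasFDerivAt f (f x • u) x) (hx : f x ≠ 0) :
    HasFDerivAt (fun y => (f y)⁻¹) ((f x)⁻¹ • (-u)) x := by
  refine ((hasDerivAt_inv hx).comp_hasFDerivAt x hf).congr_fderiv ?_
  ext w
  simp
  field_simp

theorem hasFDerivAt_log_of_ne_zero {u : E →L[ℝ] ℝ} (hf : HasFDerivAt f u x) (hx : f x ≠ 0) :
    HasFDerivAt f (f x • ((f x)⁻¹ • u)) x := by
  rwa [smul_smul, mul_inv_cancel₀ hx, one_smul]

theorem hasFDerivAt_log_prod {ι : Type*} (s : Finset ι) {f : ι → E → ℝ} {u : ι → E →L[ℝ] ℝ}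
    (hf : ∀ i ∈ s, HasFDerivAt (f i) (f i x • u i) x) :
    HasFDerivAt (fun y => ∏ i ∈ s, f i y) ((∏ i ∈ s, f i x) • ∑ i ∈ s, u i) x := by
  classical
  induction s using Finset.induction_on with
  | empty => simpa using hasFDerivAt_const (1 : ℝ) x
  | insert i s hi ih =>
    simp only [Finset.prod_insert hi, Finset.sum_insert hi]
    exact hasFDerivAt_log_mul (hf i (Finset.mem_insert_self i s))
      (ih fun j hj => hf j (Finset.mem_insert_of_mem hj))

end LogarithmicGradients

/-! ### Calculus rules for coordinate partial derivatives. -/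

section PartialDerivatives

variable {n : ℕ} {f g : (Fin n → ℝ) → ℝ} {x : Fin n → ℝ}

theorem HasFDerivAt.partialD_eq {u : (Fin n → ℝ) →L[ℝ] ℝ} (h : HasFDerivAt f u x) (i : Fin n) :
    partialD i f x = u (Pi.single i 1) := by
  rw [partialD, h.fderiv]

theorem Filter.EventuallyEq.partialD_eq (h : f =ᶠ[nhds x] g) (i : Fin n) :
    partialD i f x = partialD i g x := by
  rw [partialD, partialD, h.fderiv_eq]

theorem partialD_const (i : Fin n) (c : ℝ) : partialD i (fun _ => c) x = 0 := by
  simp [partialD]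

theorem partialD_add (hf : DifferentiableAt ℝ f x) (hg : DifferentiableAt ℝ g x) (i : Fin n) :
    partialD i (fun y => f y + g y) x = partialD i f x + partialD i g x := by
  simp [partialD, fderiv_fun_add hf hg]

theorem partialD_sub (hf : DifferentiableAt ℝ f x) (hg : DifferentiableAt ℝ g x) (i : Fin n) :
    partialD i (fun y => f y - g y) x = partialD i f x - partialD i g x := by
  simp [partialD, fderiv_fun_sub hf hg]

theorem partialD_mul (hf : DifferentiableAt ℝ f x) (hg : DifferentiableAt ℝ g x) (i : Fin n) :
    partialD i (fun y => f y * g y) x = partialD i f x * g x + f x * partialD i g x := by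
  simp [partialD, fderiv_fun_mul hf hg]
  ring

theorem partialD_const_mul (hf : DifferentiableAt ℝ f x) (c : ℝ) (i : Fin n) :
    partialD i (fun y => c * f y) x = c * partialD i f x := by
  simp [partialD, fderiv_const_mul hf]

theorem partialD_sum {ι : Type*} (s : Finset ι) {f : ι → (Fin n → ℝ) → ℝ}
    (hf : ∀ k ∈ s, DifferentiableAt ℝ (f k) x) (i : Fin n) :
    partialD i (fun y => ∑ k ∈ s, f k y) x = ∑ k ∈ s, partialD i (f k) x := by
  simp [partialD, fderiv_fun_sum hf]

theorem partialD_apply (i k : Fin n) :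
    partialD i (fun y => y k) x = if k = i then 1 else 0 := by
  rw [(hasFDerivAt_apply k x).partialD_eq]
  simp [Pi.single_apply]

theorem partialD_inv (hf : DifferentiableAt ℝ f x) (hx : f x ≠ 0) (i : Fin n) :
    partialD i (fun y => (f y)⁻¹) x = -((f x)⁻¹ * (f x)⁻¹ * partialD i f x) := by
  have h := ((hasDerivAt_inv hx).comp_hasFDerivAt x hf.hasFDerivAt).partialD_eq i
  refine h.trans ?_
  simp only [smul_apply, smul_eq_mul, partialD]
  field_simp

end PartialDerivatives

/-! ### The interlacing domain: openness and nonvanishing of the metric coefficients. -/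

section EllipsoidalDomain

variable {n : ℕ} {a : Fin (n + 1) → ℝ} {x : Fin n → ℝ}

theorem isOpen_ellipsoidalDomain (a : Fin (n + 1) → ℝ) : IsOpen (ellipsoidalDomain a) := by
  have : ellipsoidalDomain a =
      ⋂ i : Fin n, {x | a i.castSucc < x i} ∩ {x | x i < a i.succ} := by
    ext x
    simp [ellipsoidalDomain]
  rw [this]
  exact isOpen_iInter_of_finite fun i =>
    (isOpen_lt continuous_const (continuous_apply i)).inter
      (isOpen_lt (continuous_apply i) continuous_const)

theorem strictMono_of_mem_ellipsoidalDomain (ha : StrictMono a) (hx : x ∈ ellipsoidalDomain a) :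
    StrictMono x := fun i j hij =>
  ((hx i).2.trans_le (ha.monotone (Fin.succ_le_castSucc_iff.2 hij))).trans (hx j).1

theorem pos_of_mem_ellipsoidalDomain (ha0 : 0 < a 0) (ha : StrictMono a)
    (hx : x ∈ ellipsoidalDomain a) (i : Fin n) : 0 < x i :=
  (ha0.trans_le (ha.monotone (Fin.zero_le _))).trans (hx i).1

theorem ne_of_mem_ellipsoidalDomain (ha : StrictMono a) (hx : x ∈ ellipsoidalDomain a) (i : Fin n)
    (α : Fin (n + 1)) : x i ≠ a α := by
  rcases lt_or_ge i.castSucc α with h | h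
  · exact ((hx i).2.trans_le (ha.monotone (Fin.castSucc_lt_iff_succ_le.1 h))).ne
  · exact ((ha.monotone h).trans_lt (hx i).1).ne'

theorem dualMoserCoeff_ne_zero (ha0 : 0 < a 0) (ha : StrictMono a)
    (hx : x ∈ ellipsoidalDomain a) (i : Fin n) : dualMoserCoeff a x i ≠ 0 := by
  unfold dualMoserCoeff neumannCoeff
  have h1 : ∏ j ∈ Finset.univ.erase i, (x i - x j) ≠ 0 := Finset.prod_ne_zero_iff.2 fun j hj =>
    sub_ne_zero.2 fun h => (Finset.mem_erase.1 hj).1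
      ((strictMono_of_mem_ellipsoidalDomain ha hx).injective h.symm)
  have h2 : ∏ α, (x i - a α) ≠ 0 := Finset.prod_ne_zero_iff.2 fun α _ =>
    sub_ne_zero.2 (ne_of_mem_ellipsoidalDomain ha hx i α)
  have h3 := (pos_of_mem_ellipsoidalDomain ha0 ha hx i).ne'
  positivity

end EllipsoidalDomain

/-! ### Christoffel symbols and their first derivatives. -/

section Christoffel

variable {n : ℕ} {a : Fin (n + 1) → ℝ} {x : Fin n → ℝ}

/-- The partial derivative `∂_k log |g_l|` of the dual Moser coefficients. -/
noncomputable def logCoeffPartial (a : Fin (n + 1) → ℝ) (x : Fin n → ℝ) (l k : Fin n) : ℝ :=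
  if l = k then ∑ s ∈ Finset.univ.erase l, (x l - x s)⁻¹ - ∑ α, (x l - a α)⁻¹ - (x l)⁻¹
  else (x k - x l)⁻¹

theorem logCoeffPartial_of_ne {l k : Fin n} (h : l ≠ k) :
    logCoeffPartial a x l k = (x k - x l)⁻¹ := if_neg h

theorem logCoeffPartial_self (l : Fin n) :
    logCoeffPartial a x l l =
      ∑ s ∈ Finset.univ.erase l, (x l - x s)⁻¹ - ∑ α, (x l - a α)⁻¹ - (x l)⁻¹ := if_pos rfl

theorem hasFDerivAt_dualMoserCoeff (ha0 : 0 < a 0) (ha : StrictMono a)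
    (hx : x ∈ ellipsoidalDomain a) (l : Fin n) :
    ∃ u : (Fin n → ℝ) →L[ℝ] ℝ,
      HasFDerivAt (fun y => dualMoserCoeff a y l) (dualMoserCoeff a x l • u) x ∧
      ∀ k, u (Pi.single k 1) = logCoeffPartial a x l k := by
  have hinj := (strictMono_of_mem_ellipsoidalDomain ha hx).injective
  have hα := ne_of_mem_ellipsoidalDomain ha hx l
  have hl := (pos_of_mem_ellipsoidalDomain ha0 ha hx l).ne'
  have h1 := hasFDerivAt_log_prod (x := x) (Finset.univ.erase l)
    (f := fun s y => y l - y s) fun s hs =>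
      hasFDerivAt_log_of_ne_zero ((hasFDerivAt_apply l x).sub (hasFDerivAt_apply s x))
        (sub_ne_zero.2 fun h => (Finset.mem_erase.1 hs).1 (hinj h.symm))
  have h2 := hasFDerivAt_log_inv (hasFDerivAt_log_prod (x := x) Finset.univ
    (f := fun α y => y l - a α) fun α _ =>
      hasFDerivAt_log_of_ne_zero ((hasFDerivAt_apply l x).sub_const (a α))
        (sub_ne_zero.2 (hα α)))
    (Finset.prod_ne_zero_iff.2 fun α _ => sub_ne_zero.2 (hα α))
  have h3 := hasFDerivAt_log_inv (hasFDerivAt_log_of_ne_zero (hasFDerivAt_apply l x) hl) hl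
  have h0 : HasFDerivAt (fun _ : Fin n → ℝ => (-(1 / 4) : ℝ))
      ((-(1 / 4) : ℝ) • (0 : (Fin n → ℝ) →L[ℝ] ℝ)) x := by
    simpa using hasFDerivAt_const (-(1 / 4) : ℝ) x
  have h := hasFDerivAt_log_mul (hasFDerivAt_log_mul h0 (hasFDerivAt_log_mul h1 h2)) h3
  refine ⟨_, h, fun k => ?_⟩
  by_cases hk : l = k
  · subst hk
    rw [logCoeffPartial_self]
    simp only [zero_add, sum_apply, smul_apply, sub_apply, smul_eq_mul,
      ContinuousLinearMap.proj_apply, Pi.single_eq_same, mul_one, ← sub_eq_add_neg]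
    congr 2
    refine Finset.sum_congr rfl fun s hs => ?_
    rw [Pi.single_eq_of_ne (Finset.mem_erase.1 hs).1, sub_zero, mul_one]
  · rw [logCoeffPartial_of_ne hk]
    simp [Pi.single_apply, hk]
    rw [← inv_neg, neg_sub]

theorem partialD_dualMoserMetric (ha0 : 0 < a 0) (ha : StrictMono a)
    (hx : x ∈ ellipsoidalDomain a) (l j i : Fin n) :
    partialD i (fun y => dualMoserMetric a y l j) x =
      if l = j then dualMoserCoeff a x l * logCoeffPartial a x l i else 0 := by
  split_ifs with h
  · subst h
    obtain ⟨u, hu, huk⟩ := hasFDerivAt_dualMoserCoeff ha0 ha hx l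
    simp only [dualMoserMetric, Matrix.diagonal_apply_eq]
    rw [hu.partialD_eq, smul_apply, huk, smul_eq_mul]
  · simp only [dualMoserMetric, Matrix.diagonal_apply_ne _ h]
    exact partialD_const i 0

theorem inv_dualMoserMetric (ha0 : 0 < a 0) (ha : StrictMono a) (hx : x ∈ ellipsoidalDomain a) :
    (dualMoserMetric a x)⁻¹ = Matrix.diagonal fun i => (dualMoserCoeff a x i)⁻¹ := by
  refine Matrix.inv_eq_right_inv ?_
  rw [dualMoserMetric, Matrix.diagonal_mul_diagonal]
  simp [mul_inv_cancel₀ (dualMoserCoeff_ne_zero ha0 ha hx _)]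

/-- Diagonality leaves only the summand `l = k`, and each derivative of `g_l` is `g_l` times a
logarithmic partial. -/
theorem christoffel_dualMoserMetric (ha0 : 0 < a 0) (ha : StrictMono a)
    (hx : x ∈ ellipsoidalDomain a) (k i j : Fin n) :
    christoffel (dualMoserMetric a) x k i j = 1 / 2 *
      ((if k = i then logCoeffPartial a x k j else 0)
        + (if k = j then logCoeffPartial a x k i else 0)
        - if i = j then dualMoserCoeff a x i * (dualMoserCoeff a x k)⁻¹ *
            logCoeffPartial a x i k else 0) := by
  have hk := dualMoserCoeff_ne_zero ha0 ha hx k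
  rw [christoffel, inv_dualMoserMetric ha0 ha hx, Finset.sum_eq_single k]
  · simp only [partialD_dualMoserMetric ha0 ha hx, Matrix.diagonal_apply_eq]
    split_ifs <;> field_simp <;> ring
  · intro l _ hl
    rw [Matrix.diagonal_apply_ne _ hl.symm, zero_mul]
  · simp

theorem differentiableAt_logCoeffPartial (ha0 : 0 < a 0) (ha : StrictMono a)
    (hx : x ∈ ellipsoidalDomain a) (l k : Fin n) :
    DifferentiableAt ℝ (fun y => logCoeffPartial a y l k) x := by
  have hinj := (strictMono_of_mem_ellipsoidalDomain ha hx).injective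
  have hα := ne_of_mem_ellipsoidalDomain ha hx l
  have hl := (pos_of_mem_ellipsoidalDomain ha0 ha hx l).ne'
  by_cases h : l = k
  · subst h
    simp only [logCoeffPartial_self]
    refine ((DifferentiableAt.fun_sum fun s hs => ?_).sub
      (DifferentiableAt.fun_sum fun α _ => ?_)).sub ?_
    · exact (DifferentiableAt.inv (by fun_prop)
        (sub_ne_zero.2 fun h => (Finset.mem_erase.1 hs).1 (hinj h.symm)))
    · exact (DifferentiableAt.inv (by fun_prop) (sub_ne_zero.2 (hα α)))
    · exact (DifferentiableAt.inv (by fun_prop) hl)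
  · simp only [logCoeffPartial_of_ne h]
    exact DifferentiableAt.inv (by fun_prop) (sub_ne_zero.2 fun h' => h (hinj h'.symm))

theorem differentiableAt_dualMoserCoeff (ha0 : 0 < a 0) (ha : StrictMono a)
    (hx : x ∈ ellipsoidalDomain a) (l : Fin n) :
    DifferentiableAt ℝ (fun y => dualMoserCoeff a y l) x :=
  (hasFDerivAt_dualMoserCoeff ha0 ha hx l).choose_spec.1.differentiableAt

theorem partialD_dualMoserCoeff (ha0 : 0 < a 0) (ha : StrictMono a)
    (hx : x ∈ ellipsoidalDomain a) (l i : Fin n) :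
    partialD i (fun y => dualMoserCoeff a y l) x =
      dualMoserCoeff a x l * logCoeffPartial a x l i := by
  simpa [dualMoserMetric] using partialD_dualMoserMetric ha0 ha hx l l i

theorem partialD_logCoeffPartial_of_ne (ha : StrictMono a)
    (hx : x ∈ ellipsoidalDomain a) {l k : Fin n} (h : l ≠ k) (m : Fin n) :
    partialD m (fun y => logCoeffPartial a y l k) x =
      ((if l = m then 1 else 0) - (if k = m then 1 else 0)) *
        ((x k - x l)⁻¹ * (x k - x l)⁻¹) := by
  have hinj := (strictMono_of_mem_ellipsoidalDomain ha hx).injective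
  simp only [logCoeffPartial_of_ne h]
  rw [partialD_inv (by fun_prop) (sub_ne_zero.2 fun h' => h (hinj h'.symm)),
    partialD_sub (by fun_prop) (by fun_prop), partialD_apply, partialD_apply]
  ring

/-- Only the summand `s = m` depends on `x m`. The case `l = m` is not needed: `∂_l B_ll` does not
enter the curvature. -/
theorem partialD_logCoeffPartial_self (ha0 : 0 < a 0) (ha : StrictMono a)
    (hx : x ∈ ellipsoidalDomain a) {l m : Fin n} (h : l ≠ m) :
    partialD m (fun y => logCoeffPartial a y l l) x =
        (x l - x m)⁻¹ * (x l - x m)⁻¹ := by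
  have hinj := (strictMono_of_mem_ellipsoidalDomain ha hx).injective
  have hα := ne_of_mem_ellipsoidalDomain ha hx l
  have hl := (pos_of_mem_ellipsoidalDomain ha0 ha hx l).ne'
  have hs : ∀ s ∈ Finset.univ.erase l, x l - x s ≠ 0 := fun s hs =>
    sub_ne_zero.2 fun h => (Finset.mem_erase.1 hs).1 (hinj h.symm)
  have d1 : ∀ s ∈ Finset.univ.erase l,
      DifferentiableAt ℝ (fun y : Fin n → ℝ => (y l - y s)⁻¹) x := fun s h =>
    DifferentiableAt.inv (by fun_prop) (hs s h)
  have d2 : ∀ α ∈ Finset.univ,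
      DifferentiableAt ℝ (fun y : Fin n → ℝ => (y l - a α)⁻¹) x := fun α _ =>
    DifferentiableAt.inv (by fun_prop) (sub_ne_zero.2 (hα α))
  have d3 : DifferentiableAt ℝ (fun y : Fin n → ℝ => (y l)⁻¹) x :=
    DifferentiableAt.inv (by fun_prop) hl
  simp only [logCoeffPartial_self]
  rw [partialD_sub ((DifferentiableAt.fun_sum d1).fun_sub (DifferentiableAt.fun_sum d2)) d3,
    partialD_sub (DifferentiableAt.fun_sum d1) (DifferentiableAt.fun_sum d2), partialD_sum _ d1,
    partialD_sum _ d2, partialD_inv (by fun_prop) hl, partialD_apply, if_neg h,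
    Finset.sum_eq_single m]
  · rw [Finset.sum_eq_zero]
    · rw [partialD_inv (by fun_prop) (sub_ne_zero.2 (hinj.ne h)),
        partialD_sub (by fun_prop) (by fun_prop), partialD_apply, partialD_apply, if_neg h,
        if_pos rfl]
      ring
    · intro α _
      rw [partialD_inv (by fun_prop) (sub_ne_zero.2 (hα α)),
        partialD_sub (by fun_prop) (by fun_prop), partialD_apply, partialD_const, if_neg h]
      ring
  · intro s hs' hsm
    rw [partialD_inv (by fun_prop) (hs s hs'),
      partialD_sub (by fun_prop) (by fun_prop), partialD_apply, partialD_apply, if_neg h,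
      if_neg hsm]
    ring
  · simp [Ne.symm h]

/-- The formula for the symbols holds on an open set, so it may be differentiated; the ratio `g_i /
g_k` contributes its logarithmic derivative `B_im - B_km`. -/
theorem partialD_christoffel_dualMoserMetric (ha0 : 0 < a 0) (ha : StrictMono a)
    (hx : x ∈ ellipsoidalDomain a) (m k i j : Fin n) :
    partialD m (fun y => christoffel (dualMoserMetric a) y k i j) x = 1 / 2 *
      ((if k = i then partialD m (fun y => logCoeffPartial a y k j) x else 0)
        + (if k = j then partialD m (fun y => logCoeffPartial a y k i) x else 0)
        - if i = j then dualMoserCoeff a x i * (dualMoserCoeff a x k)⁻¹ *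
            (partialD m (fun y => logCoeffPartial a y i k) x + logCoeffPartial a x i k *
              (logCoeffPartial a x i m - logCoeffPartial a x k m)) else 0) := by
  have hev : (fun y => christoffel (dualMoserMetric a) y k i j) =ᶠ[nhds x] _ :=
    Filter.eventuallyEq_of_mem ((isOpen_ellipsoidalDomain a).mem_nhds hx) fun y hy =>
      christoffel_dualMoserMetric ha0 ha hy k i j
  have dB := differentiableAt_logCoeffPartial ha0 ha hx
  have dg := differentiableAt_dualMoserCoeff ha0 ha hx
  have hk := dualMoserCoeff_ne_zero ha0 ha hx k
  have dgi : DifferentiableAt ℝ (fun y => (dualMoserCoeff a y k)⁻¹) x := (dg k).inv hk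
  have d1 : DifferentiableAt ℝ (fun y => if k = i then logCoeffPartial a y k j else 0) x := by
    split_ifs
    exacts [dB _ _, differentiableAt_const _]
  have d2 : DifferentiableAt ℝ (fun y => if k = j then logCoeffPartial a y k i else 0) x := by
    split_ifs
    exacts [dB _ _, differentiableAt_const _]
  have d3 : DifferentiableAt ℝ (fun y => if i = j then dualMoserCoeff a y i *
      (dualMoserCoeff a y k)⁻¹ * logCoeffPartial a y i k else 0) x := by
    split_ifs
    exacts [((dg i).fun_mul dgi).mul (dB _ _), differentiableAt_const _]
  rw [hev.partialD_eq, partialD_const_mul ((d1.fun_add d2).fun_sub d3), partialD_sub (d1.fun_add d2) d3,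
    partialD_add d1 d2]
  congr 3
  · split_ifs
    exacts [rfl, partialD_const _ _]
  · split_ifs
    exacts [rfl, partialD_const _ _]
  · split_ifs
    · rw [partialD_mul ((dg i).fun_mul dgi) (dB i k), partialD_mul (dg i) dgi,
        partialD_inv (dg k) hk, partialD_dualMoserCoeff ha0 ha hx,
        partialD_dualMoserCoeff ha0 ha hx]
      field_simp
      ring
    · exact partialD_const _ _

end Christoffel

/-! ### Riemann, Ricci, scalar, Schouten, Weyl and Cotton tensors. -/

section Curvature

variable {n : ℕ} {a : Fin (n + 1) → ℝ} {x : Fin n → ℝ}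

-- This is the divided difference of `P = X ∏ (X - a_α)` with `x l` and `x i` doubled: `P` has
-- degree `n + 2`, two more than the number of nodes, and `P' / P` at the doubled nodes supplies the
-- `a`-dependent part of `logCoeffPartial`.
open Polynomial in
theorem sum_logCoeffPartial_mul_inv_dualMoserCoeff (ha0 : 0 < a 0) (ha : StrictMono a)
    (hx : x ∈ ellipsoidalDomain a) {l i : Fin n} (h : l ≠ i) :
    ∑ s ∈ (Finset.univ.erase l).erase i,
        logCoeffPartial a x l s * logCoeffPartial a x i s * (dualMoserCoeff a x s)⁻¹ =
      -4 * (x l + x i + ∑ k, x k - ∑ α, a α)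
        + (dualMoserCoeff a x l)⁻¹ * (logCoeffPartial a x l l + (x l - x i)⁻¹) * (x l - x i)⁻¹
        + (dualMoserCoeff a x i)⁻¹ * (logCoeffPartial a x i i + (x i - x l)⁻¹) *
          (x i - x l)⁻¹ := by
  have hinj := (strictMono_of_mem_ellipsoidalDomain ha hx).injective
  set N : ℝ[X] := Lagrange.nodal Finset.univ a with hN
  have hNm : N.Monic := Lagrange.nodal_monic
  have hPm : (X * N).Monic := monic_X.mul hNm
  have hdeg : (X * N).natDegree = (Finset.univ : Finset (Fin n)).card + 2 := by
    rw [monic_X.natDegree_mul hNm, natDegree_X, hN, Lagrange.natDegree_nodal]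
    simp
    omega
  have hnext : (X * N).nextCoeff = -∑ α, a α := by
    have h1 : (X : ℝ[X]).nextCoeff = 0 := by simpa using nextCoeff_X_sub_C (0 : ℝ)
    rw [monic_X.nextCoeff_mul hNm, h1, zero_add, hN, Lagrange.nodal, prod_X_sub_C_nextCoeff]
  have hev : ∀ s, N.eval (x s) = ∏ α, (x s - a α) := fun s => Lagrange.eval_nodal
  have hinv : ∀ s, (dualMoserCoeff a x s)⁻¹ =
      -4 * ((X * N).eval (x s) * (∏ m ∈ Finset.univ.erase s, (x s - x m))⁻¹) := by
    intro s
    rw [eval_mul, eval_X, hev, dualMoserCoeff, neumannCoeff]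
    simp only [div_eq_mul_inv, mul_inv, inv_inv]
    norm_num
    ring
  have hder : ∀ s, (derivative (X * N)).eval (x s) =
      (X * N).eval (x s) * (∑ α, (x s - a α)⁻¹ + (x s)⁻¹) := by
    intro s
    have h0 := (pos_of_mem_ellipsoidalDomain ha0 ha hx s).ne'
    rw [derivative_mul, eval_add, eval_mul, eval_mul, derivative_X, eval_one, hN,
      eval_derivative_nodal_eq_mul_sum_inv _ _ _
        (fun α _ => ne_of_mem_ellipsoidalDomain ha hx s α), ← hN, eval_mul, hev, eval_X]
    field_simp
    ring
  have key := sum_eval_mul_nodalWeight_two_double_nodes Finset.univ x hinj.injOn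
    (Finset.mem_univ l) (Finset.mem_univ i) h (X * N) hPm hdeg
  rw [hder, hder, hnext] at key
  have hsum : ∑ s ∈ (Finset.univ.erase l).erase i,
        logCoeffPartial a x l s * logCoeffPartial a x i s * (dualMoserCoeff a x s)⁻¹ =
      -4 * ∑ k ∈ (Finset.univ.erase l).erase i, (X * N).eval (x k) *
        ((x k - x l)⁻¹ * (x k - x i)⁻¹) * (∏ m ∈ Finset.univ.erase k, (x k - x m))⁻¹ := by
    rw [Finset.mul_sum]
    refine Finset.sum_congr rfl fun s hs => ?_
    rw [logCoeffPartial_of_ne (Finset.ne_of_mem_erase (Finset.mem_of_mem_erase hs)).symm,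
      logCoeffPartial_of_ne (Finset.ne_of_mem_erase hs).symm, hinv]
    ring
  rw [hsum, key, hinv, hinv, logCoeffPartial_self, logCoeffPartial_self]
  ring

theorem riemann_antisymm (G : (Fin n → ℝ) → Matrix (Fin n) (Fin n) ℝ) (l i j k : Fin n) :
    riemann G x l i k j = -riemann G x l i j k := by
  simp only [riemann, Finset.sum_sub_distrib]
  ring

/-- The Kronecker deltas collapse the quadratic terms of the Riemann tensor to a single contraction,
present only for `l = j`; `sum_logCoeffPartial_mul_christoffel` evaluates it on a Christoffel
symbol. -/
theorem sum_christoffel_dualMoserMetric_mul (ha0 : 0 < a 0) (ha : StrictMono a)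
    (hx : x ∈ ellipsoidalDomain a) (l j : Fin n) (Y : Fin n → ℝ) :
    ∑ s, christoffel (dualMoserMetric a) x l s j * Y s = 1 / 2 *
      (logCoeffPartial a x l j * Y l
        + (if l = j then ∑ s, logCoeffPartial a x l s * Y s else 0)
        - dualMoserCoeff a x j * (dualMoserCoeff a x l)⁻¹ * logCoeffPartial a x j l * Y j) := by
  simp only [christoffel_dualMoserMetric ha0 ha hx, add_mul, sub_mul, mul_assoc, ite_mul, zero_mul,
    ← Finset.mul_sum, Finset.sum_add_distrib, Finset.sum_sub_distrib, Finset.sum_ite_eq,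
    Finset.sum_ite_eq', Finset.mem_univ, if_true]
  split_ifs <;> simp

theorem sum_logCoeffPartial_mul_christoffel (ha0 : 0 < a 0) (ha : StrictMono a)
    (hx : x ∈ ellipsoidalDomain a) (l i k : Fin n) :
    ∑ s, logCoeffPartial a x l s * christoffel (dualMoserMetric a) x s i k = 1 / 2 *
      (logCoeffPartial a x l i * logCoeffPartial a x i k
        + logCoeffPartial a x l k * logCoeffPartial a x k i
        - if i = k then dualMoserCoeff a x i * ∑ s, logCoeffPartial a x l s *
            logCoeffPartial a x i s * (dualMoserCoeff a x s)⁻¹ else 0) := by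
  have h : ∀ s, logCoeffPartial a x l s * christoffel (dualMoserMetric a) x s i k = 1 / 2 *
      ((if s = i then logCoeffPartial a x l s * logCoeffPartial a x s k else 0)
        + (if s = k then logCoeffPartial a x l s * logCoeffPartial a x s i else 0)
        - if i = k then dualMoserCoeff a x i * (logCoeffPartial a x l s *
            logCoeffPartial a x i s * (dualMoserCoeff a x s)⁻¹) else 0) := by
    intro s
    rw [christoffel_dualMoserMetric ha0 ha hx]
    split_ifs <;> ring
  simp only [h, ← Finset.mul_sum, Finset.sum_add_distrib, Finset.sum_sub_distrib,
    Finset.sum_ite_eq', Finset.mem_univ, if_true]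
  split_ifs <;> simp [Finset.mul_sum]

theorem riemann_dualMoserMetric_sectional (ha0 : 0 < a 0) (ha : StrictMono a)
    (hx : x ∈ ellipsoidalDomain a) {l i : Fin n} (h : l ≠ i) :
    riemann (dualMoserMetric a) x l i l i =
      (x l + x i + ∑ k, x k - ∑ α, a α) * dualMoserCoeff a x i := by
  have hinj := (strictMono_of_mem_ellipsoidalDomain ha hx).injective
  have hli : x l - x i ≠ 0 := sub_ne_zero.2 (hinj.ne h)
  have hgl := dualMoserCoeff_ne_zero ha0 ha hx l
  have hgi := dualMoserCoeff_ne_zero ha0 ha hx i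
  have key := sum_logCoeffPartial_mul_inv_dualMoserCoeff ha0 ha hx h
  have hmem : i ∈ (Finset.univ : Finset (Fin n)).erase l := by simp [h.symm]
  rw [riemann, Finset.sum_sub_distrib, sum_christoffel_dualMoserMetric_mul ha0 ha hx,
    sum_christoffel_dualMoserMetric_mul ha0 ha hx,
    sum_logCoeffPartial_mul_christoffel ha0 ha hx]
  simp only [partialD_christoffel_dualMoserMetric ha0 ha hx, christoffel_dualMoserMetric ha0 ha hx,
    if_true, if_neg h, if_neg h.symm]
  -- The summands `s = l` and `s = i`, excluded from `key`, are split off. The sum enters with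
  -- coefficient `-g_i / 4`, which cancels the `-4` of `key`.
  rw [← Finset.add_sum_erase _ _ (Finset.mem_univ l), ← Finset.add_sum_erase _ _ hmem, key,
    partialD_logCoeffPartial_of_ne ha hx h, partialD_logCoeffPartial_of_ne ha hx h.symm,
    logCoeffPartial_of_ne h, logCoeffPartial_of_ne h.symm, if_neg h, if_neg h.symm,
    if_pos rfl, if_pos rfl, ← neg_sub (x l) (x i), inv_neg]
  field_simp
  ring

/-- For `j = l` the second-order terms cancel because `∂_l B_lk = ∂_k B_ll`; for `j ≠ l` the
derivatives of `B_lj` and `B_lk` involved vanish. -/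
theorem riemann_dualMoserMetric_self (ha0 : 0 < a 0) (ha : StrictMono a)
    (hx : x ∈ ellipsoidalDomain a) {l k : Fin n} (h : l ≠ k) (j : Fin n) (hjk : j ≠ k) :
    riemann (dualMoserMetric a) x l l j k = 0 := by
  have hinj := (strictMono_of_mem_ellipsoidalDomain ha hx).injective
  have hlk : x l - x k ≠ 0 := sub_ne_zero.2 (hinj.ne h)
  have hgl := dualMoserCoeff_ne_zero ha0 ha hx l
  have hgk := dualMoserCoeff_ne_zero ha0 ha hx k
  rw [riemann, Finset.sum_sub_distrib, sum_christoffel_dualMoserMetric_mul ha0 ha hx,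
    sum_christoffel_dualMoserMetric_mul ha0 ha hx,
    sum_logCoeffPartial_mul_christoffel ha0 ha hx]
  simp only [partialD_christoffel_dualMoserMetric ha0 ha hx, christoffel_dualMoserMetric ha0 ha hx]
  by_cases hj : l = j
  · subst hj
    simp only [if_true, if_neg h, if_neg h.symm]
    rw [partialD_logCoeffPartial_of_ne ha hx h, partialD_logCoeffPartial_self ha0 ha hx h,
      logCoeffPartial_of_ne h, logCoeffPartial_of_ne h.symm, if_pos rfl, if_neg h.symm,
      ← neg_sub (x l) (x k), inv_neg]
    field_simp
    ring
  · simp only [if_true, if_neg h, if_neg h.symm, if_neg hj, if_neg (Ne.symm hj), if_neg hjk,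
      if_neg hjk.symm]
    rw [partialD_logCoeffPartial_of_ne ha hx h, partialD_logCoeffPartial_of_ne ha hx hj,
      if_neg hj, if_neg hjk, if_neg h, if_neg hjk.symm]
    ring

/-- With `j` equal to `l` or `i`, what remains is a partial fraction identity in the differences of
the three coordinates `x l`, `x i`, `x k`; for any other `j` nothing remains. -/
theorem riemann_dualMoserMetric_of_ne (ha0 : 0 < a 0) (ha : StrictMono a)
    (hx : x ∈ ellipsoidalDomain a) {l i j k : Fin n} (hli : l ≠ i) (hlk : l ≠ k) (hik : i ≠ k)
    (hjk : j ≠ k) :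
    riemann (dualMoserMetric a) x l i j k = 0 := by
  have hinj := (strictMono_of_mem_ellipsoidalDomain ha hx).injective
  have hxlk : x l - x k ≠ 0 := sub_ne_zero.2 (hinj.ne hlk)
  have hxli : x l - x i ≠ 0 := sub_ne_zero.2 (hinj.ne hli)
  have hxik : x i - x k ≠ 0 := sub_ne_zero.2 (hinj.ne hik)
  have hgl := dualMoserCoeff_ne_zero ha0 ha hx l
  have hgi := dualMoserCoeff_ne_zero ha0 ha hx i
  have hgk := dualMoserCoeff_ne_zero ha0 ha hx k
  rw [riemann, Finset.sum_sub_distrib, sum_christoffel_dualMoserMetric_mul ha0 ha hx,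
    sum_christoffel_dualMoserMetric_mul ha0 ha hx,
    sum_logCoeffPartial_mul_christoffel ha0 ha hx]
  simp only [partialD_christoffel_dualMoserMetric ha0 ha hx, christoffel_dualMoserMetric ha0 ha hx]
  by_cases hlj : l = j
  · subst hlj
    simp only [if_true, if_neg hli, if_neg hlk, if_neg hik, if_neg hli.symm, if_neg hlk.symm,
      if_neg hik.symm]
    rw [partialD_logCoeffPartial_of_ne ha hx hli, logCoeffPartial_of_ne hli,
      logCoeffPartial_of_ne hlk, logCoeffPartial_of_ne hik, logCoeffPartial_of_ne hik.symm,
      if_neg hlk, if_neg hik, ← neg_sub (x l) (x k), inv_neg, ← neg_sub (x l) (x i), inv_neg,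
      ← neg_sub (x i) (x k), inv_neg]
    field_simp
    ring
  · by_cases hij : i = j
    · subst hij
      simp only [if_true, if_neg hli, if_neg hlk, if_neg hik, if_neg hik.symm]
      rw [partialD_logCoeffPartial_of_ne ha hx hli.symm, logCoeffPartial_of_ne hli.symm,
        logCoeffPartial_of_ne hlk, logCoeffPartial_of_ne hlk.symm, logCoeffPartial_of_ne hik,
        if_neg hlk, if_neg hik, ← neg_sub (x l) (x k), inv_neg,
        ← neg_sub (x i) (x k), inv_neg]
      field_simp
      ring
    · simp only [if_neg hli, if_neg hlk, if_neg hik, if_neg hlj, if_neg hij, if_neg hjk,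
        if_neg hjk.symm, if_neg (Ne.symm hij), if_neg hik.symm]
      ring

theorem riemann_dualMoserMetric (ha0 : 0 < a 0) (ha : StrictMono a)
    (hx : x ∈ ellipsoidalDomain a) (l i j k : Fin n) :
    riemann (dualMoserMetric a) x l i j k =
      (x l + x i + ∑ k, x k - ∑ α, a α) * dualMoserCoeff a x i *
        ((if l = j then 1 else 0) * (if i = k then 1 else 0)
          - (if l = k then 1 else 0) * (if i = j then 1 else 0)) := by
  have hzero : ∀ j k : Fin n, l ≠ k → i ≠ k → j ≠ k →
      riemann (dualMoserMetric a) x l i j k = 0 := by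
    intro j k hlk hik hjk
    by_cases hli : l = i
    · subst hli
      exact riemann_dualMoserMetric_self ha0 ha hx hlk j hjk
    · exact riemann_dualMoserMetric_of_ne ha0 ha hx hli hlk hik hjk
  rcases eq_or_ne j k with rfl | hjk
  · have := riemann_antisymm (x := x) (dualMoserMetric a) l i j j
    have h0 : riemann (dualMoserMetric a) x l i j j = 0 := by linarith
    rw [h0]
    ring
  by_cases hk : l ≠ k ∧ i ≠ k
  · rw [hzero j k hk.1 hk.2 hjk, if_neg hk.1, if_neg hk.2]
    ring
  by_cases hj : l ≠ j ∧ i ≠ j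
  · rw [riemann_antisymm, hzero k j hj.1 hj.2 hjk.symm, if_neg hj.1, if_neg hj.2]
    ring
  -- Up to antisymmetry, a component with `j` or `k` outside `{l, i}` is already zero.
  have hcases : (l = j ∧ i = k) ∨ (l = k ∧ i = j) := by
    by_contra hcon
    push Not at hcon hk hj
    by_cases hlk : l = k
    · exact hcon.2 hlk (hj fun h => hjk (h.symm.trans hlk))
    · exact hcon.1 (by_contra fun h => hjk ((hj h).symm.trans (hk hlk))) (hk hlk)
  rcases hcases with ⟨rfl, rfl⟩ | ⟨rfl, rfl⟩
  · rw [riemann_dualMoserMetric_sectional ha0 ha hx hjk, if_neg hjk]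
    simp
  · rw [riemann_antisymm, riemann_dualMoserMetric_sectional ha0 ha hx hjk.symm, if_neg hjk.symm]
    simp

theorem ricci_dualMoserMetric (ha0 : 0 < a 0) (ha : StrictMono a)
    (hx : x ∈ ellipsoidalDomain a) (i j : Fin n) :
    ricci (dualMoserMetric a) x i j =
      (((n : ℝ) - 2) * x i + (n : ℝ) * ∑ k, x k - ((n : ℝ) - 1) * ∑ α, a α)
        * dualMoserCoeff a x i * (if i = j then 1 else 0) := by
  have h : ∀ s, riemann (dualMoserMetric a) x s i s j =
      (if i = j then 1 else 0) * dualMoserCoeff a x i *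
        ((x i + ∑ k, x k - ∑ α, a α) + x s
          - if s = i then (x i + x i + ∑ k, x k - ∑ α, a α) else 0) := by
    intro s
    rw [riemann_dualMoserMetric ha0 ha hx]
    by_cases hij : i = j <;> by_cases hsi : s = i
    · subst hij hsi; simp only [if_true]; ring
    · subst hij; simp [hsi, Ne.symm hsi]; ring
    · subst hsi; simp [hij]
    · simp only [hij, if_true, if_false, Ne.symm hsi]; ring
  rw [ricci, Finset.sum_congr rfl fun s _ => h s, ← Finset.mul_sum, Finset.sum_sub_distrib,
    Finset.sum_add_distrib, Finset.sum_const, Finset.sum_ite_eq', if_pos (Finset.mem_univ i),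
    Finset.card_univ, Fintype.card_fin, nsmul_eq_mul]
  ring

theorem scalarCurvature_dualMoserMetric (ha0 : 0 < a 0) (ha : StrictMono a)
    (hx : x ∈ ellipsoidalDomain a) :
    scalarCurvature (dualMoserMetric a) x =
      ((n : ℝ) - 1) * (((n : ℝ) + 2) * ∑ k, x k - (n : ℝ) * ∑ α, a α) := by
  have h : ∀ i, ∑ j, (dualMoserMetric a x)⁻¹ i j * ricci (dualMoserMetric a) x i j =
      ((n : ℝ) - 2) * x i + ((n : ℝ) * ∑ k, x k - ((n : ℝ) - 1) * ∑ α, a α) := by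
    intro i
    have hi := dualMoserCoeff_ne_zero ha0 ha hx i
    rw [inv_dualMoserMetric ha0 ha hx, Finset.sum_eq_single i]
    · rw [ricci_dualMoserMetric ha0 ha hx, Matrix.diagonal_apply_eq, if_pos rfl]
      field_simp
      ring
    · intro j _ hj
      rw [Matrix.diagonal_apply_ne _ hj.symm, zero_mul]
    · simp
  rw [scalarCurvature, Finset.sum_congr rfl fun i _ => h i, Finset.sum_add_distrib,
    ← Finset.mul_sum, Finset.sum_const, Finset.card_univ, Fintype.card_fin, nsmul_eq_mul]
  ring

theorem schouten_dualMoserMetric (hn : 3 ≤ n) (ha0 : 0 < a 0) (ha : StrictMono a)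
    (hx : x ∈ ellipsoidalDomain a) (i j : Fin n) :
    schouten (dualMoserMetric a) x i j =
      if i = j then (x i + (∑ k, x k - ∑ α, a α) / 2) * dualMoserCoeff a x i else 0 := by
  have hn' : (3 : ℝ) ≤ n := by exact_mod_cast hn
  have h1 : (n : ℝ) - 1 ≠ 0 := by linarith
  have h2 : (n : ℝ) - 2 ≠ 0 := by linarith
  rw [schouten, ricci_dualMoserMetric ha0 ha hx, scalarCurvature_dualMoserMetric ha0 ha hx]
  split_ifs with h
  · subst h
    rw [dualMoserMetric, Matrix.diagonal_apply_eq]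
    field_simp
    ring
  · rw [dualMoserMetric, Matrix.diagonal_apply_ne _ h]
    simp

/-- With `c = ∑ x - ∑ a`, the sectional curvature `x l + x i + c` is the sum of the Schouten
eigenvalues `x l + c / 2` and `x i + c / 2`. -/
theorem weyl_dualMoserMetric (hn : 3 ≤ n) (ha0 : 0 < a 0) (ha : StrictMono a)
    (hx : x ∈ ellipsoidalDomain a) (l i j k : Fin n) :
    weyl (dualMoserMetric a) x l i j k = 0 := by
  rw [weyl, riemannLow, Finset.sum_eq_single l]
  · simp only [schouten_dualMoserMetric hn ha0 ha hx, riemann_dualMoserMetric ha0 ha hx,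
      dualMoserMetric, Matrix.diagonal_apply]
    rw [if_true]
    split_ifs <;> ring
  · intro m _ hm
    rw [dualMoserMetric, Matrix.diagonal_apply_ne _ hm.symm, zero_mul]
  · simp

/-- The right side is `(g_ij ∂_k σ + g_jk ∂_i σ + g_ki ∂_j σ) / 2` with `σ = ∑ x`; its total
symmetry is what kills the Cotton tensor. -/
theorem covSchouten_dualMoserMetric (hn : 3 ≤ n) (ha0 : 0 < a 0) (ha : StrictMono a)
    (hx : x ∈ ellipsoidalDomain a) (k i j : Fin n) :
    covSchouten (dualMoserMetric a) x k i j = 1 / 2 *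
      ((if i = j then dualMoserCoeff a x i else 0) + (if j = k then dualMoserCoeff a x j else 0)
        + if k = i then dualMoserCoeff a x k else 0) := by
  have hinj := (strictMono_of_mem_ellipsoidalDomain ha hx).injective
  have dg := differentiableAt_dualMoserCoeff ha0 ha hx
  have hev : (fun y => schouten (dualMoserMetric a) y i j) =ᶠ[nhds x] _ :=
    Filter.eventuallyEq_of_mem ((isOpen_ellipsoidalDomain a).mem_nhds hx) fun y hy =>
      schouten_dualMoserMetric hn ha0 ha hy i j
  have hpD : partialD k (fun y => schouten (dualMoserMetric a) y i j) x =
      if i = j then (((if i = k then 1 else 0) + 1 / 2) +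
        (x i + (∑ k, x k - ∑ α, a α) / 2) * logCoeffPartial a x i k) * dualMoserCoeff a x i
      else 0 := by
    rw [hev.partialD_eq]
    by_cases h : i = j
    · have hd : DifferentiableAt ℝ (fun y : Fin n → ℝ => (∑ k, y k - ∑ α, a α) * 2⁻¹) x := by
        fun_prop
      simp only [div_eq_mul_inv, one_mul, if_pos h]
      rw [partialD_mul (by fun_prop) (dg i), partialD_add (by fun_prop) hd,
        partialD_mul (by fun_prop) (by fun_prop), partialD_sub (by fun_prop) (by fun_prop),
        partialD_sum _ (fun _ _ => by fun_prop), partialD_const, partialD_const,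
        partialD_dualMoserCoeff ha0 ha hx]
      simp only [partialD_apply, Finset.sum_ite_eq', Finset.mem_univ, if_true]
      ring
    · simp only [if_neg h]
      exact partialD_const _ _
  have hsum : ∑ s, (christoffel (dualMoserMetric a) x s k i * schouten (dualMoserMetric a) x s j
      + christoffel (dualMoserMetric a) x s k j * schouten (dualMoserMetric a) x i s) =
      christoffel (dualMoserMetric a) x j k i *
        ((x j + (∑ k, x k - ∑ α, a α) / 2) * dualMoserCoeff a x j)
      + christoffel (dualMoserMetric a) x i k j *
        ((x i + (∑ k, x k - ∑ α, a α) / 2) * dualMoserCoeff a x i) := by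
    simp only [schouten_dualMoserMetric hn ha0 ha hx, mul_ite, mul_zero, Finset.sum_add_distrib,
      Finset.sum_ite_eq, Finset.sum_ite_eq', Finset.mem_univ, if_true]
  -- The pole of an off-diagonal `B_pq` cancels against the difference `x p - x q` of Schouten
  -- eigenvalues.
  have hB : ∀ p q : Fin n, p ≠ q → (x p - x q) * logCoeffPartial a x p q = -1 := by
    intro p q hpq
    have : x p - x q ≠ 0 := sub_ne_zero.2 (hinj.ne hpq)
    rw [logCoeffPartial_of_ne hpq, ← neg_sub (x p) (x q), inv_neg, mul_neg, mul_inv_cancel₀ this]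
  have hgi := dualMoserCoeff_ne_zero ha0 ha hx i
  have hgj := dualMoserCoeff_ne_zero ha0 ha hx j
  rw [covSchouten, hpD, hsum, christoffel_dualMoserMetric ha0 ha hx,
    christoffel_dualMoserMetric ha0 ha hx]
  by_cases hij : i = j
  · subst hij
    by_cases hik : i = k
    · subst hik
      simp only [if_true]
      field_simp
      ring
    · simp only [if_true, if_neg hik, if_neg (Ne.symm hik)]
      ring
  · by_cases hik : i = k
    · subst hik
      simp only [if_true, if_neg hij, if_neg (Ne.symm hij)]
      have := hB i j hij
      field_simp
      linear_combination (-2 * dualMoserCoeff a x i) * this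
    · by_cases hjk : j = k
      · subst hjk
        simp only [if_true, if_neg hij, if_neg (Ne.symm hij)]
        have := hB j i (Ne.symm hij)
        field_simp
        linear_combination (-2 * dualMoserCoeff a x j) * this
      · simp only [if_neg hij, if_neg (Ne.symm hij), if_neg hjk, if_neg (Ne.symm hjk), if_neg hik,
          if_neg (Ne.symm hik)]
        ring

theorem cotton_dualMoserMetric (hn : 3 ≤ n) (ha0 : 0 < a 0) (ha : StrictMono a)
    (hx : x ∈ ellipsoidalDomain a) (i j k : Fin n) :
    cotton (dualMoserMetric a) x i j k = 0 := by
  rw [cotton, covSchouten_dualMoserMetric hn ha0 ha hx, covSchouten_dualMoserMetric hn ha0 ha hx]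
  have hsymm : ∀ p q : Fin n, (if p = q then dualMoserCoeff a x p else 0) =
      if q = p then dualMoserCoeff a x q else 0 := by
    intro p q
    by_cases h : p = q
    · rw [h]
    · rw [if_neg h, if_neg (Ne.symm h)]
  rw [hsymm j k, hsymm k i, hsymm i j]
  ring

end Curvature

/-! ### The light cone embedding and its stereographic projection. -/

section ConformalFlatness

open Finset

variable {n : ℕ} {a : Fin (n + 1) → ℝ} {x : Fin n → ℝ}

/-- The zeros `0, a₀, …, aₙ` of the denominators of the dual Moser coefficients. -/
noncomputable def coneNodes (a : Fin (n + 1) → ℝ) : Fin (n + 2) → ℝ := Fin.cons 0 a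

theorem coneNodes_zero : coneNodes a 0 = 0 := rfl

theorem coneNodes_succ (α : Fin (n + 1)) : coneNodes a α.succ = a α := rfl

/-- The squares, up to sign, of the coordinates of an embedding of the ellipsoidal domain into the
light cone of `ℝ^{1,n+1}`, pulling the Minkowski form back to the dual Moser metric. -/
noncomputable def coneSquare (a : Fin (n + 1) → ℝ) (x : Fin n → ℝ) (k : Fin (n + 2)) : ℝ :=
  Lagrange.nodalWeight univ (coneNodes a) k * ∏ i, (coneNodes a k - x i)

theorem coneNodes_injective (ha0 : 0 < a 0) (ha : StrictMono a) :
    Function.Injective (coneNodes a) := by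
  refine Fin.cons_injective_iff.2 ⟨?_, ha.injective⟩
  rintro ⟨α, hα⟩
  exact (ha0.trans_le (ha.monotone (Fin.zero_le α))).ne' hα

theorem ne_coneNodes (ha0 : 0 < a 0) (ha : StrictMono a) (hx : x ∈ ellipsoidalDomain a)
    (i : Fin n) (k : Fin (n + 2)) : x i ≠ coneNodes a k := by
  refine Fin.cases ?_ (fun α => ?_) k
  · exact (pos_of_mem_ellipsoidalDomain ha0 ha hx i).ne'
  · exact ne_of_mem_ellipsoidalDomain ha hx i α

/-- The light cone condition: `∏ (X - x i)` has degree `n`, and the weights of `n + 2` nodes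
annihilate degrees up to `n`. -/
theorem sum_coneSquare (ha0 : 0 < a 0) (ha : StrictMono a) :
    ∑ k, coneSquare a x k = 0 := by
  have h := sum_nodalWeight_mul_eval_eq_zero univ (coneNodes a)
    (coneNodes_injective ha0 ha).injOn (Lagrange.nodal univ x) (by simp)
  simpa only [Lagrange.eval_nodal, coneSquare] using h

theorem coneSquare_mul_inv (ha0 : 0 < a 0) (ha : StrictMono a) (hx : x ∈ ellipsoidalDomain a)
    (i : Fin n) (k : Fin (n + 2)) :
    coneSquare a x k * (x i - coneNodes a k)⁻¹ =
      -(Lagrange.nodalWeight univ (coneNodes a) k *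
        ∏ s ∈ univ.erase i, (coneNodes a k - x s)) := by
  have h := sub_ne_zero.2 (ne_coneNodes ha0 ha hx i k)
  rw [coneSquare, ← mul_prod_erase univ _ (mem_univ i), ← neg_sub (x i)]
  field_simp

/-- Tangent vectors are orthogonal to the position vector on the cone. Cancelling one factor leaves
a polynomial of degree `n - 1`. -/
theorem sum_coneSquare_mul_inv (ha0 : 0 < a 0) (ha : StrictMono a) (hx : x ∈ ellipsoidalDomain a)
    (i : Fin n) :
    ∑ k, coneSquare a x k * (x i - coneNodes a k)⁻¹ = 0 := by
  have h := sum_nodalWeight_mul_eval_eq_zero univ (coneNodes a)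
    (coneNodes_injective ha0 ha).injOn (Lagrange.nodal (univ.erase i) x) (by simp)
  simp only [Lagrange.eval_nodal] at h
  simp only [coneSquare_mul_inv ha0 ha hx, sum_neg_distrib, h, neg_zero]

/-- Four times the pullback of the Minkowski form. For `i ≠ j` both poles cancel and a polynomial of
degree `n - 2` is annihilated; for `i = j` one pole survives, and the sum is Lagrange's formula at
`x i` for `∏_{s ≠ i} (X - x s)`. -/
theorem sum_coneSquare_mul_inv_mul_inv (ha0 : 0 < a 0) (ha : StrictMono a)
    (hx : x ∈ ellipsoidalDomain a) (i j : Fin n) :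
    ∑ k, coneSquare a x k * ((x i - coneNodes a k)⁻¹ * (x j - coneNodes a k)⁻¹) =
      4 * if i = j then dualMoserCoeff a x i else 0 := by
  have hn : 0 < n := i.pos
  by_cases hij : i = j
  · subst hij
    have h0 := (pos_of_mem_ellipsoidalDomain ha0 ha hx i).ne'
    have hα : ∏ α, (x i - a α) ≠ 0 := prod_ne_zero_iff.2 fun α _ =>
      sub_ne_zero.2 (ne_of_mem_ellipsoidalDomain ha hx i α)
    have hdeg : (Lagrange.nodal (univ.erase i) x).degree < #(univ : Finset (Fin (n + 2))) := by
      rw [Lagrange.degree_nodal]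
      simp only [card_erase_of_mem (mem_univ i), card_univ, Fintype.card_fin]
      exact_mod_cast (by omega : n - 1 < n + 2)
    have h := Lagrange.eval_interpolate_not_at_node (s := univ) (v := coneNodes a)
      (fun k => (Lagrange.nodal (univ.erase i) x).eval (coneNodes a k))
      (x := x i) (fun k _ => ne_coneNodes ha0 ha hx i k)
    rw [← Lagrange.eq_interpolate (coneNodes_injective ha0 ha).injOn hdeg] at h
    simp only [Lagrange.eval_nodal, Fin.prod_univ_succ (n := n + 1), coneNodes_zero,
      coneNodes_succ, sub_zero] at h
    have hs : ∑ k, coneSquare a x k * ((x i - coneNodes a k)⁻¹ * (x i - coneNodes a k)⁻¹) =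
        -∑ k, Lagrange.nodalWeight univ (coneNodes a) k * (x i - coneNodes a k)⁻¹ *
          ∏ s ∈ univ.erase i, (coneNodes a k - x s) := by
      rw [← sum_neg_distrib]
      refine sum_congr rfl fun k _ => ?_
      rw [← mul_assoc, coneSquare_mul_inv ha0 ha hx]
      ring
    rw [hs, if_pos rfl, dualMoserCoeff, neumannCoeff, h]
    field_simp
  · have h := sum_nodalWeight_mul_eval_eq_zero univ (coneNodes a)
      (coneNodes_injective ha0 ha).injOn (Lagrange.nodal ((univ.erase i).erase j) x)
      (by rw [Lagrange.natDegree_nodal]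
          have := card_le_card (subset_univ ((univ.erase i).erase j))
          simp only [card_univ, Fintype.card_fin] at this ⊢
          omega)
    rw [if_neg hij, mul_zero, ← h]
    refine sum_congr rfl fun k _ => ?_
    have hj := sub_ne_zero.2 (ne_coneNodes ha0 ha hx j k)
    rw [← mul_assoc, coneSquare_mul_inv ha0 ha hx, Lagrange.eval_nodal,
      ← mul_prod_erase (univ.erase i) _ (mem_erase.2 ⟨Ne.symm hij, mem_univ j⟩), ← neg_sub (x j)]
    field_simp

theorem prod_erase_eq_prod_succAbove {M : Type*} [CommMonoid M] {m : ℕ} (k : Fin (m + 1))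
    (f : Fin (m + 1) → M) : ∏ j ∈ univ.erase k, f j = ∏ i, f (k.succAbove i) := by
  have h : (univ.erase k : Finset (Fin (m + 1))) = univ.map k.succAboveEmb := by
    ext j
    simp [Fin.exists_succAbove_eq_iff]
  rw [h, prod_map]
  rfl

/-- Each `0 - x i` is paired with `0 - a i.succ`; the unpaired factor `0 - a 0` gives the sign and
makes this the timelike direction. -/
theorem coneSquare_zero_neg (ha0 : 0 < a 0) (ha : StrictMono a) (hx : x ∈ ellipsoidalDomain a) :
    coneSquare a x 0 < 0 := by
  rw [coneSquare, Lagrange.nodalWeight, prod_erase_eq_prod_succAbove, Fin.prod_univ_succ, mul_assoc,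
    ← prod_mul_distrib]
  simp only [Fin.zero_succAbove, coneNodes_zero, coneNodes_succ, zero_sub]
  refine mul_neg_of_neg_of_pos (inv_neg''.2 (by linarith)) (prod_pos fun i _ => ?_)
  have h1 := pos_of_mem_ellipsoidalDomain ha0 ha hx i
  have h2 : 0 < a i.succ := ha0.trans (ha (Fin.succ_pos i))
  rw [inv_neg, neg_mul_neg]
  positivity

/-- By interlacing, `x i` lies on the same side of `a α` as the `i`-th of the remaining `a`s, so the
paired factors are positive; the factor left over is `a α - 0`. -/
theorem coneSquare_succ_pos (ha0 : 0 < a 0) (ha : StrictMono a) (hx : x ∈ ellipsoidalDomain a)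
    (α : Fin (n + 1)) : 0 < coneSquare a x α.succ := by
  rw [coneSquare, Lagrange.nodalWeight, prod_erase_eq_prod_succAbove, Fin.prod_univ_succ, mul_assoc,
    ← prod_mul_distrib]
  simp only [Fin.succ_succAbove_zero, Fin.succ_succAbove_succ, coneNodes_zero, coneNodes_succ,
    sub_zero]
  refine mul_pos (inv_pos.2 (ha0.trans_le (ha.monotone (Fin.zero_le α)))) (prod_pos fun i _ => ?_)
  rcases lt_or_ge i.castSucc α with h | h
  · rw [Fin.succAbove_of_castSucc_lt _ _ h]
    have h1 : x i < a α := (hx i).2.trans_le (ha.monotone (Fin.castSucc_lt_iff_succ_le.1 h))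
    exact mul_pos (inv_pos.2 (sub_pos.2 (ha h))) (sub_pos.2 h1)
  · rw [Fin.succAbove_of_le_castSucc _ _ h]
    have h1 : a α < x i := (ha.monotone h).trans_lt (hx i).1
    have h2 : a α < a i.succ := h1.trans (hx i).2
    exact mul_pos_of_neg_of_neg (inv_neg''.2 (sub_neg.2 h2)) (sub_neg.2 h1)

theorem hasFDerivAt_log_sqrt {E : Type*} [NormedAddCommGroup E] [NormedSpace ℝ E] {f : E → ℝ}
    {u : E →L[ℝ] ℝ} {x : E} (hf : HasFDerivAt f (f x • u) x) (hx : 0 < f x) :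
    HasFDerivAt (fun y => √(f y)) (√(f x) • ((1 / 2 : ℝ) • u)) x := by
  refine (hf.sqrt hx.ne').congr_fderiv ?_
  have h : √(f x) ≠ 0 := (Real.sqrt_pos.2 hx).ne'
  ext w
  simp only [smul_apply, smul_eq_mul]
  field_simp
  rw [Real.sq_sqrt hx.le]

/-- The coordinates of the embedding into the light cone. -/
noncomputable def coneCoord (a : Fin (n + 1) → ℝ) (x : Fin n → ℝ) (k : Fin (n + 2)) : ℝ :=
  √((if k = 0 then -1 else 1) * coneSquare a x k)

theorem sign_mul_coneSquare_pos (ha0 : 0 < a 0) (ha : StrictMono a)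
    (hx : x ∈ ellipsoidalDomain a) (k : Fin (n + 2)) :
    0 < (if k = 0 then -1 else 1) * coneSquare a x k := by
  refine Fin.cases ?_ (fun α => ?_) k
  · simpa using coneSquare_zero_neg ha0 ha hx
  · simpa using coneSquare_succ_pos ha0 ha hx α

theorem coneCoord_pos (ha0 : 0 < a 0) (ha : StrictMono a) (hx : x ∈ ellipsoidalDomain a)
    (k : Fin (n + 2)) : 0 < coneCoord a x k :=
  Real.sqrt_pos.2 (sign_mul_coneSquare_pos ha0 ha hx k)

theorem coneCoord_zero_sq (ha0 : 0 < a 0) (ha : StrictMono a) (hx : x ∈ ellipsoidalDomain a) :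
    coneCoord a x 0 ^ 2 = -coneSquare a x 0 := by
  rw [coneCoord, Real.sq_sqrt (sign_mul_coneSquare_pos ha0 ha hx 0).le]
  simp

theorem coneCoord_succ_sq (ha0 : 0 < a 0) (ha : StrictMono a) (hx : x ∈ ellipsoidalDomain a)
    (α : Fin (n + 1)) : coneCoord a x α.succ ^ 2 = coneSquare a x α.succ := by
  rw [coneCoord, Real.sq_sqrt (sign_mul_coneSquare_pos ha0 ha hx α.succ).le]
  simp

theorem hasFDerivAt_coneCoord (ha0 : 0 < a 0) (ha : StrictMono a)
    (hx : x ∈ ellipsoidalDomain a) (k : Fin (n + 2)) :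
    ∃ u : (Fin n → ℝ) →L[ℝ] ℝ,
      HasFDerivAt (fun y => coneCoord a y k) (coneCoord a x k • u) x ∧
      ∀ i, u (Pi.single i 1) = 1 / 2 * (x i - coneNodes a k)⁻¹ := by
  have h1 := hasFDerivAt_log_prod (x := x) univ (f := fun i y => coneNodes a k - y i) fun i _ =>
    hasFDerivAt_log_of_ne_zero ((hasFDerivAt_apply i x).const_sub (coneNodes a k))
      (sub_ne_zero.2 (ne_coneNodes ha0 ha hx i k).symm)
  have hc : ∀ c : ℝ, HasFDerivAt (fun _ : Fin n → ℝ => c) (c • (0 : (Fin n → ℝ) →L[ℝ] ℝ)) x :=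
    fun c => by simpa using hasFDerivAt_const c x
  have h2 := hasFDerivAt_log_mul (hc (if k = 0 then -1 else 1))
    (hasFDerivAt_log_mul (hc (Lagrange.nodalWeight univ (coneNodes a) k)) h1)
  refine ⟨_, hasFDerivAt_log_sqrt h2 (sign_mul_coneSquare_pos ha0 ha hx k), fun i => ?_⟩
  simp [Pi.single_apply]
  rw [← mul_neg, ← inv_neg, neg_sub]

theorem contDiffOn_coneCoord (ha0 : 0 < a 0) (ha : StrictMono a) (k : Fin (n + 2)) :
    ContDiffOn ℝ ∞ (fun y => coneCoord a y k) (ellipsoidalDomain a) := by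
  refine ContDiffOn.sqrt ?_ fun y hy => (sign_mul_coneSquare_pos ha0 ha hy k).ne'
  refine contDiffOn_const.mul (contDiffOn_const.mul (ContDiff.contDiffOn ?_))
  exact contDiff_prod fun i _ => contDiff_const.sub (contDiff_apply ℝ ℝ i)

/-- Stereographic projection of the light cone embedding. -/
noncomputable def conformalChart (a : Fin (n + 1) → ℝ) (x : Fin n → ℝ) (k : Fin n) : ℝ :=
  coneCoord a x k.succ.succ * (coneCoord a x 0 + coneCoord a x 1)⁻¹

theorem contDiffOn_conformalChart (ha0 : 0 < a 0) (ha : StrictMono a) :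
    ContDiffOn ℝ ∞ (conformalChart a) (ellipsoidalDomain a) := by
  refine contDiffOn_pi.2 fun k => ?_
  refine (contDiffOn_coneCoord ha0 ha _).mul (ContDiffOn.inv
    ((contDiffOn_coneCoord ha0 ha 0).add (contDiffOn_coneCoord ha0 ha 1)) fun y hy => ?_)
  exact (add_pos (coneCoord_pos ha0 ha hy 0) (coneCoord_pos ha0 ha hy 1)).ne'

theorem fderiv_conformalChart (ha0 : 0 < a 0) (ha : StrictMono a)
    (hx : x ∈ ellipsoidalDomain a) (i k : Fin n) :
    fderiv ℝ (conformalChart a) x (Pi.single i 1) k =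
      conformalChart a x k * (1 / 2 * (x i - a k.succ)⁻¹ -
        (coneCoord a x 0 + coneCoord a x 1)⁻¹ * (1 / 2 *
          (coneCoord a x 0 * (x i)⁻¹ + coneCoord a x 1 * (x i - a 0)⁻¹))) := by
  have hs := (add_pos (coneCoord_pos ha0 ha hx 0) (coneCoord_pos ha0 ha hx 1)).ne'
  choose u hu hui using fun k => hasFDerivAt_coneCoord ha0 ha hx k
  have h := fun k : Fin n => hasFDerivAt_log_mul (hu k.succ.succ)
    (hasFDerivAt_log_inv (hasFDerivAt_log_of_ne_zero ((hu 0).fun_add (hu 1)) hs) hs)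
  have hpi : HasFDerivAt (conformalChart a) _ x := hasFDerivAt_pi.2 h
  rw [hpi.fderiv]
  simp only [ContinuousLinearMap.coe_pi', smul_apply, add_apply, neg_apply, hui, smul_eq_mul,
    coneNodes_succ, coneNodes_zero, sub_zero, conformalChart]
  have h1 : coneNodes a 1 = a 0 := rfl
  rw [h1]
  ring

/-- The Minkowski form degenerates along the rays of the cone, so dividing the embedding by `y_0 +
y_1` divides the induced metric by its square, and on the slice `y_0 + y_1 = 1` that metric is
Euclidean in the other `n` coordinates. -/
theorem dualMoserMetric_eq_conformal (ha0 : 0 < a 0) (ha : StrictMono a)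
    (hx : x ∈ ellipsoidalDomain a) (i j : Fin n) :
    dualMoserMetric a x i j = (coneCoord a x 0 + coneCoord a x 1) ^ 2 *
      ∑ k, fderiv ℝ (conformalChart a) x (Pi.single i 1) k *
        fderiv ℝ (conformalChart a) x (Pi.single j 1) k := by
  have hs := (add_pos (coneCoord_pos ha0 ha hx 0) (coneCoord_pos ha0 ha hx 1)).ne'
  have e1 : coneCoord a x 1 ^ 2 = coneSquare a x 1 := coneCoord_succ_sq ha0 ha hx 0
  have h0 := sum_coneSquare (x := x) ha0 ha
  have hi := sum_coneSquare_mul_inv ha0 ha hx i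
  have hj := sum_coneSquare_mul_inv ha0 ha hx j
  have hij := sum_coneSquare_mul_inv_mul_inv ha0 ha hx i j
  simp only [Fin.sum_univ_succ (n := n + 1), Fin.sum_univ_succ (n := n), coneNodes_zero,
    coneNodes_succ, sub_zero, Fin.succ_zero_eq_one, ← e1,
    ← neg_eq_iff_eq_neg.2 (coneCoord_zero_sq ha0 ha hx)] at h0 hi hj hij
  have hsum : ∑ k, fderiv ℝ (conformalChart a) x (Pi.single i 1) k *
        fderiv ℝ (conformalChart a) x (Pi.single j 1) k =
      ((coneCoord a x 0 + coneCoord a x 1)⁻¹) ^ 2 *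
      (1 / 4 * ∑ k : Fin n, coneSquare a x k.succ.succ *
          ((x i - a k.succ)⁻¹ * (x j - a k.succ)⁻¹)
        - (coneCoord a x 0 + coneCoord a x 1)⁻¹ * (1 / 4 *
          (coneCoord a x 0 * (x j)⁻¹ + coneCoord a x 1 * (x j - a 0)⁻¹)) *
            ∑ k : Fin n, coneSquare a x k.succ.succ * (x i - a k.succ)⁻¹
        - (coneCoord a x 0 + coneCoord a x 1)⁻¹ * (1 / 4 *
          (coneCoord a x 0 * (x i)⁻¹ + coneCoord a x 1 * (x i - a 0)⁻¹)) *
            ∑ k : Fin n, coneSquare a x k.succ.succ * (x j - a k.succ)⁻¹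
        + ((coneCoord a x 0 + coneCoord a x 1)⁻¹) ^ 2 * (1 / 4 *
          (coneCoord a x 0 * (x i)⁻¹ + coneCoord a x 1 * (x i - a 0)⁻¹) *
          (coneCoord a x 0 * (x j)⁻¹ + coneCoord a x 1 * (x j - a 0)⁻¹)) *
            ∑ k : Fin n, coneSquare a x k.succ.succ) := by
    simp only [mul_sum, ← sum_sub_distrib, ← sum_add_distrib]
    refine sum_congr rfl fun k _ => ?_
    rw [fderiv_conformalChart ha0 ha hx, fderiv_conformalChart ha0 ha hx, conformalChart,
      ← coneCoord_succ_sq ha0 ha hx k.succ]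
    ring
  have hG : dualMoserMetric a x i j = if i = j then dualMoserCoeff a x i else 0 := by
    rw [dualMoserMetric, Matrix.diagonal_apply]
  -- The four cone relations express every sum over the last `n` coordinates through `y_0` and
  -- `y_1`; what is left is a rational identity in free variables.
  rw [hsum, hG, eq_sub_of_add_eq' (eq_sub_of_add_eq' h0),
    eq_sub_of_add_eq' (eq_sub_of_add_eq' hi), eq_sub_of_add_eq' (eq_sub_of_add_eq' hj),
    eq_sub_of_add_eq' (eq_sub_of_add_eq' hij)]
  generalize (x i - a 0)⁻¹ = r
  generalize (x j - a 0)⁻¹ = t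
  generalize (x i)⁻¹ = r'
  generalize (x j)⁻¹ = t'
  field_simp
  ring

/-- A kernel vector of the differential would be in the kernel of the pulled-back form, which is
diagonal with nonzero entries; surjectivity follows by dimension. -/
theorem bijective_fderiv_conformalChart (ha0 : 0 < a 0) (ha : StrictMono a)
    (hx : x ∈ ellipsoidalDomain a) :
    Function.Bijective (fderiv ℝ (conformalChart a) x) := by
  set L := fderiv ℝ (conformalChart a) x with hL
  have hinj : Function.Injective L := by
    refine (injective_iff_map_eq_zero L).2 fun v hv => ?_
    funext i
    have hLv : ∀ k, ∑ j, v j * L (Pi.single j 1) k = 0 := by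
      intro k
      have h1 : L v = ∑ j, v j • L (Pi.single j 1) := by
        conv_lhs => rw [pi_eq_sum_univ' v]
        simp
      have h2 := congrFun (h1.symm.trans hv) k
      simpa using h2
    have h : ∑ j, v j * dualMoserMetric a x i j = 0 := by
      simp only [dualMoserMetric_eq_conformal ha0 ha hx, ← hL, mul_sum]
      rw [sum_comm]
      refine sum_eq_zero fun k _ => ?_
      rw [← mul_zero ((coneCoord a x 0 + coneCoord a x 1) ^ 2 * L (Pi.single i 1) k), ← hLv k,
        mul_sum]
      exact sum_congr rfl fun j _ => by ring
    rw [sum_eq_single i (fun j _ hj => by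
      rw [dualMoserMetric, Matrix.diagonal_apply_ne _ hj.symm, mul_zero]) (by simp),
      dualMoserMetric, Matrix.diagonal_apply_eq] at h
    exact (mul_eq_zero.1 h).resolve_right (dualMoserCoeff_ne_zero ha0 ha hx i)
  exact ⟨hinj, (LinearMap.injective_iff_surjective (f := L.toLinearMap)).1 hinj⟩

theorem isConformallyFlatOn_dualMoserMetric (ha0 : 0 < a 0) (ha : StrictMono a) :
    IsConformallyFlatOn (dualMoserMetric a) (ellipsoidalDomain a) := by
  intro p hp
  have hopen := isOpen_ellipsoidalDomain a
  have hψ := contDiffOn_conformalChart ha0 ha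
  have hcd : ContDiffAt ℝ ∞ (conformalChart a) p := hψ.contDiffAt (hopen.mem_nhds hp)
  have h1 : (∞ : WithTop ℕ∞) ≠ 0 := by simp
  -- The inverse function theorem needs the differential as a continuous linear equivalence; the
  -- source of the local inverse supplies the injectivity on `W`, and the conformal exponent is `log
  -- (y_0 + y_1)`.
  let e : (Fin n → ℝ) ≃L[ℝ] (Fin n → ℝ) := (LinearEquiv.ofBijective
    (fderiv ℝ (conformalChart a) p).toLinearMap
    (bijective_fderiv_conformalChart ha0 ha hp)).toContinuousLinearEquiv
  have he : HasFDerivAt (conformalChart a) (e : (Fin n → ℝ) →L[ℝ] (Fin n → ℝ)) p :=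
    (hcd.differentiableAt h1).hasFDerivAt
  have hmem := hcd.mem_toOpenPartialHomeomorph_source he h1
  have hinj := (hcd.toOpenPartialHomeomorph (conformalChart a) he h1).injOn
  refine ⟨ellipsoidalDomain a ∩ (hcd.toOpenPartialHomeomorph (conformalChart a) he h1).source,
    hopen.inter (OpenPartialHomeomorph.open_source _), ⟨hp, hmem⟩, Set.inter_subset_left,
    conformalChart a, fun x => Real.log (coneCoord a x 0 + coneCoord a x 1),
    hψ.mono Set.inter_subset_left, ?_, hinj.mono Set.inter_subset_right, ?_⟩
  · refine ContDiffOn.mono (ContDiffOn.log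
      ((contDiffOn_coneCoord ha0 ha 0).add (contDiffOn_coneCoord ha0 ha 1)) fun y hy => ?_)
      Set.inter_subset_left
    exact (add_pos (coneCoord_pos ha0 ha hy 0) (coneCoord_pos ha0 ha hy 1)).ne'
  · rintro x ⟨hx, -⟩
    refine ⟨bijective_fderiv_conformalChart ha0 ha hx, fun i j => ?_⟩
    have hs := add_pos (coneCoord_pos ha0 ha hx 0) (coneCoord_pos ha0 ha hx 1)
    rw [dualMoserMetric_eq_conformal ha0 ha hx, two_mul (Real.log _), Real.exp_add,
      Real.exp_log hs, sq]

end ConformalFlatness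

theorem lemma3p10 (n : ℕ) (a : Fin (n + 1) → ℝ) (ha_pos : 0 < a 0) (ha_mono : StrictMono a) :
    (∀ x ∈ ellipsoidalDomain a, ∀ i j : Fin n,
      ricci (dualMoserMetric a) x i j =
        (((n : ℝ) - 2) * x i + (n : ℝ) * ∑ k, x k - ((n : ℝ) - 1) * ∑ α, a α)
          * dualMoserCoeff a x i * (if i = j then 1 else 0)) ∧
    (∀ x ∈ ellipsoidalDomain a,
      scalarCurvature (dualMoserMetric a) x =
        ((n : ℝ) - 1) * (((n : ℝ) + 2) * ∑ k, x k - (n : ℝ) * ∑ α, a α)) ∧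
    (3 ≤ n → IsConformallyFlatOn (dualMoserMetric a) (ellipsoidalDomain a)) ∧
    (4 ≤ n → ∀ x ∈ ellipsoidalDomain a, ∀ l i j k : Fin n,
      weyl (dualMoserMetric a) x l i j k = 0) ∧
    (n = 3 → ∀ x ∈ ellipsoidalDomain a, ∀ i j k : Fin n,
      cotton (dualMoserMetric a) x i j k = 0) := by
  refine ⟨fun x hx => ricci_dualMoserMetric ha_pos ha_mono hx,
    fun x hx => scalarCurvature_dualMoserMetric ha_pos ha_mono hx,
    fun _ => isConformallyFlatOn_dualMoserMetric ha_pos ha_mono,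
    fun hn x hx => weyl_dualMoserMetric (by omega) ha_pos ha_mono hx,
    fun hn x hx => cotton_dualMoserMetric hn.ge ha_pos ha_mono hx⟩
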